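/- All graphs are finite, simple and undirected. For $r\in\mathbb{N}=\{0,1,2,\dots\}$, a graph $H$ is an $r$-shallow minor of a graph $G$ if there are pairwise vertex-disjoint connected subgraphs $(B_h)_{h\in V(H)}$ of $G$, each of radius at most $r$, such that for every edge $uv$ of $H$ there is an edge of $G$ between a vertex of $B_u$ and a vertex of $B_v$. A class $\mathcal{C}$ of graphs is nowhere dense if for every $r\in\mathbb{N}$ there is $t\in\mathbb{N}$ such that the clique $K_t$ is not an $r$-shallow minor of any $G\in\mathcal{C}$. For a graph $G$ and $X\subseteq V(G)$ let $N_r(X)$ be the set of vertices at distance at most $r$ from some vertex of $X$. For $k,r\in\mathbb{N}$ and $A\subseteq V(G)$, a $(k,r)$-cowitness for the pair $(A,G)$ is a set $Q\subseteq V(G)$ such that for every $X\subseteq A$ with $|X|=k$ and $A\subseteq N_r(X)$, and for every $a\in A$, there is a walk in $G$ of length at most $r$ (vertices may be repeated) that begins at $a$, ends at a vertex of $X$, and passes through a vertex of $Q$. **Theorem 1.8 (Characterization by small cowitnesses).** Let $\mathcal{C}$ be a class of graphs closed under taking subgraphs. The following conditions are equivalent: 1. $\mathcal{C}$ is nowhere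 dense; 2. for all $r,k\in\mathbb{N}$ there is a constant $c$ such that for every $G\in\mathcal{C}$ and every $A\subseteq V(G)$ there is a $(k,r)$-cowitness for the pair $(A,G)$ of size at most $c$; 3. for every $r\in\mathbb{N}$ there is a constant $c$ such that for every $G\in\mathcal{C}$ there is a $(1,r)$-cowitness for the pair $(V(G),G)$ of size at most $c$. -/

import Mathlib

universe u v

/-- A finite simple graph (vertex set and edges); the empty graph is allowed. -/
structure FinGraph : Type (u + 1) where
  /-- the vertex set -/
  V : Type u
  [finite : Finite V]
  /-- the adjacency structure -/
  graph : SimpleGraph V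

attribute [instance] FinGraph.finite

/-- A subgraph of a finite graph, seen as a finite graph of its own. -/
def FinGraph.ofSubgraph (G : FinGraph.{u}) (H : G.graph.Subgraph) : FinGraph.{u} where
  V := H.verts
  graph := H.coe

/-- A class of graphs is closed under taking (not necessarily induced) subgraphs. -/
def SubgraphClosed (C : Set FinGraph.{u}) : Prop :=
  ∀ G ∈ C, ∀ H : G.graph.Subgraph, G.ofSubgraph H ∈ C

namespace SimpleGraph

variable {V : Type u} {W : Type v}

/-- `H` is an `r`-shallow minor of `G`: there are pairwise vertex-disjoint connected subgraphs
`B h` of `G`, one for each vertex `h` of `H`, each of radius at most `r` (distances being measured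
inside `B h`), such that for each edge `uv` of `H` some edge of `G` joins `B u` to `B v`. -/
def IsShallowMinor (r : ℕ) (H : SimpleGraph W) (G : SimpleGraph V) : Prop :=
  ∃ B : W → G.Subgraph,
    (∀ h, (B h).Connected) ∧
    (∀ h, (B h).coe.radius ≤ r) ∧
    (∀ h h', h ≠ h' → Disjoint (B h).verts (B h').verts) ∧
    ∀ u v, H.Adj u v → ∃ u' ∈ (B u).verts, ∃ v' ∈ (B v).verts, G.Adj u' v'

/-- `N_r(X)`: the vertices at distance at most `r` from some vertex of `X` (vertices in different
connected components are at infinite distance). -/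
def neighborhoodWithin (G : SimpleGraph V) (r : ℕ) (X : Set V) : Set V :=
  {v | ∃ x ∈ X, G.edist v x ≤ r}

/-- `Q` captures the pair `(Y, z)`: some path of length at most `r` starts at `z`, ends at a vertex
of `Y` and passes through a vertex of `Q`. Paths may repeat vertices, so this says
that `dist(z, q) + dist(q, y) ≤ r` for some `q ∈ Q` and `y ∈ Y`. -/
def Captures (G : SimpleGraph V) (r : ℕ) (Q Y : Set V) (z : V) : Prop :=
  ∃ y ∈ Y, ∃ p : G.Walk z y, p.length ≤ r ∧ ∃ q ∈ Q, q ∈ p.support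

/-- `Q` is a `(k, r)`-cowitness for the pair `(A, G)`. -/
def IsCowitness (G : SimpleGraph V) (k r : ℕ) (A : Set V) (Q : Set V) : Prop :=
  ∀ X : Finset V, (X : Set V) ⊆ A → X.card = k → A ⊆ G.neighborhoodWithin r X →
    ∀ a ∈ A, G.Captures r Q X a

end SimpleGraph

/-- A class of graphs is nowhere dense if for every `r` some clique `K_t` is an `r`-shallow minor
of no graph of the class. -/
def NowhereDense (C : Set FinGraph.{u}) : Prop :=
  ∀ r : ℕ, ∃ t : ℕ, ∀ G ∈ C,
    ¬ SimpleGraph.IsShallowMinor r (SimpleGraph.completeGraph (Fin t)) G.graph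

/-! From nowhere density to cowitnesses: the candidate sets `X` are sorted by a branching process.
It keeps a vertex set `T` and treats together all `X` with the same distance profile on `T`. Whether
`T` captures `(X, a)` depends only on that profile (`Captures.congr`), so if `T` fails for one `X`
at a vertex `a`, it fails at `a` for the whole group. Then `a` is recorded, `T` grows by `a` and by
short walks from earlier recorded vertices to `a`, and the group splits into boundedly many
profiles. If the depth is bounded, the union of the final sets is a cowitness of bounded size
(`exists_forall_captures`).

The depth is bounded because nowhere dense classes are uniformly quasi-wide
(`NowhereDense.exists_scattered`). A recorded vertex reaches `X` by a walk of length at most `r`,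
which avoids the set held when it was recorded. In a long history, many recorded vertices reach the
same `x ∈ X`, and deleting at most `s` vertices leaves `2 * (s + 1)` of these pairwise far apart.
Taken in consecutive pairs, they are joined through `x` by short walks; the history stores such
walks in disjoint layers, and each of the `s + 1` layers needs its own deleted vertex
(`History.le_card_inter`), which is impossible.

Conversely, a class that is not nowhere dense contains, for some `l`, arbitrarily large cliques
subdivided by paths of length at most `l` (`exists_hasSubdivision_of_hasCliqueMinor`). With `l`
minimal, Ramsey gives large ones with no path shorter than `l`. Take the union of such paths as a
subgraph and let `r = l + l / 2`: every branch vertex alone dominates it, but a closed walk of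
length less than `2 * l` at a branch vertex stays in its open star. A vertex lies in at most two
open stars, so a cowitness has at least half as many elements as there are branch vertices
(`IsSubdivisionFrame.exists_subgraph`). -/

namespace SimpleGraph

/-! ### Walks confined to a vertex set, and clique minors given by vertex sets. -/

/-- `u` and `v` are joined by a walk of length at most `n` all of whose vertices lie in `U`. -/
def Within {V : Type*} (G : SimpleGraph V) (U : Set V) (n : ℕ) (u v : V) : Prop :=
  ∃ p : G.Walk u v, p.length ≤ n ∧ ∀ w ∈ p.support, w ∈ U

namespace Within

variable {V : Type*} {G : SimpleGraph V} {U U' : Set V} {m n : ℕ} {u v w : V}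

lemma refl (hu : u ∈ U) : G.Within U n u u :=
  ⟨.nil, by simp, by simpa using hu⟩

lemma symm (h : G.Within U n u v) : G.Within U n v u := by
  obtain ⟨p, hp, hU⟩ := h
  exact ⟨p.reverse, by simpa using hp, by simpa using hU⟩

lemma trans (h : G.Within U m u v) (h' : G.Within U n v w) : G.Within U (m + n) u w := by
  obtain ⟨p, hp, hU⟩ := h
  obtain ⟨q, hq, hU'⟩ := h'
  refine ⟨p.append q, by rw [Walk.length_append]; omega, fun x hx => ?_⟩
  rcases (Walk.mem_support_append_iff _ _).1 hx with h | h
  exacts [hU x h, hU' x h]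

lemma mono (h : G.Within U m u v) (hU : U ⊆ U') (hmn : m ≤ n) : G.Within U' n u v := by
  obtain ⟨p, hp, hpU⟩ := h
  exact ⟨p, hp.trans hmn, fun x hx => hU (hpU x hx)⟩

lemma mem_left (h : G.Within U n u v) : u ∈ U := by
  obtain ⟨p, -, hU⟩ := h
  exact hU u p.start_mem_support

lemma mem_right (h : G.Within U n u v) : v ∈ U := h.symm.mem_left

lemma of_adj (h : G.Adj u v) (hu : u ∈ U) (hv : v ∈ U) : G.Within U 1 u v :=
  ⟨h.toWalk, by simp, by simp [hu, hv]⟩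

lemma eq_of_zero (h : G.Within U 0 u v) : u = v := by
  obtain ⟨p, hp, -⟩ := h
  exact Walk.eq_of_length_eq_zero (Nat.le_zero.1 hp)

lemma exists_first (h : G.Within U (n + 1) u v) :
    u = v ∨ ∃ w, u ∈ U ∧ G.Adj u w ∧ G.Within U n w v := by
  obtain ⟨p, hp, hU⟩ := h
  cases p with
  | nil => exact Or.inl rfl
  | cons hadj q =>
    refine Or.inr ⟨_, hU _ (by simp), hadj, q, by simpa using hp, fun x hx => hU x (by simp [hx])⟩

lemma exists_last (h : G.Within U (n + 1) u v) :
    ∃ w, G.Within U n u w ∧ (w = v ∨ G.Adj w v) := by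
  rcases h.symm.exists_first with rfl | ⟨w, -, hvw, hw⟩
  · exact ⟨v, refl h.mem_left, Or.inl rfl⟩
  · exact ⟨w, hw.symm, Or.inr hvw.symm⟩

lemma split (h : G.Within U (m + n) u v) :
    ∃ w, G.Within U m u w ∧ G.Within U n w v := by
  induction m generalizing u with
  | zero => exact ⟨u, refl h.mem_left, by simpa using h⟩
  | succ m ih =>
    rw [show m + 1 + n = m + n + 1 by omega] at h
    rcases h.exists_first with rfl | ⟨w, hu, huw, hw⟩
    · exact ⟨u, refl h.mem_left, refl h.mem_left⟩
    · obtain ⟨x, hwx, hxv⟩ := ih hw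
      exact ⟨x, ((of_adj huw hu hw.mem_left).trans hwx).mono le_rfl (by omega), hxv⟩

/-- Prefixes of a walk from `u` stay in the ball around `u`, so a ball has the required radius
inside itself and can serve as a branch set. -/
lemma within_ball (h : G.Within U n u v) : G.Within {x | G.Within U n u x} n u v := by
  classical
  obtain ⟨p, hp, hU⟩ := h
  refine ⟨p, hp, fun x hx => ⟨p.takeUntil x hx, (p.length_takeUntil_le_length hx).trans hp, fun y hy =>
    hU y (p.support_takeUntil_subset_support hx hy)⟩⟩

end Within

/-- `K_t` is an `r`-shallow minor, with branch sets given as vertex sets with centers. -/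
def HasCliqueMinor {V : Type*} (G : SimpleGraph V) (r t : ℕ) : Prop :=
  ∃ (c : Fin t → V) (B : Fin t → Set V),
    (∀ i, c i ∈ B i) ∧ (∀ i, ∀ v ∈ B i, G.Within (B i) r (c i) v) ∧
    (∀ i j, i ≠ j → Disjoint (B i) (B j)) ∧
    ∀ i j, i < j → ∃ u ∈ B i, ∃ v ∈ B j, G.Adj u v

lemma HasCliqueMinor.mono {V : Type*} {G : SimpleGraph V} {r r' t t' : ℕ}
    (h : G.HasCliqueMinor r t) (hr : r ≤ r') (ht : t' ≤ t) : G.HasCliqueMinor r' t' := by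
  obtain ⟨c, B, h1, h2, h3, h4⟩ := h
  refine ⟨c ∘ Fin.castLE ht, B ∘ Fin.castLE ht, fun i => h1 _,
    fun i v hv => (h2 _ v hv).mono subset_rfl hr, fun i j hij => h3 _ _ ?_,
    fun i j hij => h4 _ _ (by simpa using hij)⟩
  exact fun h => hij (Fin.castLE_injective ht h)

lemma HasCliqueMinor.exists_adj {V : Type*} {G : SimpleGraph V} {t : ℕ} {B : Fin t → Set V}
    (h : ∀ i j, i < j → ∃ u ∈ B i, ∃ v ∈ B j, G.Adj u v) (i j : Fin t) (hij : i ≠ j) :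
    ∃ u ∈ B i, ∃ v ∈ B j, G.Adj u v := by
  rcases lt_or_gt_of_ne hij with hij | hij
  · exact h i j hij
  · obtain ⟨u, hu, v, hv, huv⟩ := h j i hij
    exact ⟨v, hv, u, hu, huv.symm⟩

lemma Subgraph.exists_coe_walk_of_within {V : Type*} {G : SimpleGraph V} (H : G.Subgraph)
    {U : Set V} (hU : U ⊆ H.verts) (hadj : ∀ x ∈ U, ∀ y ∈ U, G.Adj x y → H.Adj x y)
    {n : ℕ} {u v : V} (h : G.Within U n u v) :
    ∃ p : H.coe.Walk ⟨u, hU h.mem_left⟩ ⟨v, hU h.mem_right⟩, p.length ≤ n := by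
  induction n generalizing u with
  | zero => obtain rfl := h.eq_of_zero; exact ⟨.nil, by simp⟩
  | succ n ih =>
    rcases h.exists_first with rfl | ⟨w, hu, huw, hw⟩
    · exact ⟨.nil, by simp⟩
    · obtain ⟨p, hp⟩ := ih hw
      have hadj' : H.coe.Adj ⟨u, hU hu⟩ ⟨w, hU hw.mem_left⟩ := hadj u hu w hw.mem_left huw
      exact ⟨.cons hadj' p, by simpa using hp⟩

lemma Subgraph.within_of_coe_walk {V : Type*} {G : SimpleGraph V} (H : G.Subgraph)
    {x y : H.verts} (p : H.coe.Walk x y) : G.Within H.verts p.length x y := by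
  induction p with
  | nil => exact .refl (Subtype.property _)
  | cons h q ih =>
    rw [Walk.length_cons, add_comm]
    exact (Within.of_adj (H.adj_sub h) (Subtype.property _) (Subtype.property _)).trans ih

lemma exists_walk_length_le_of_edist_le {V : Type*} {G : SimpleGraph V} {r : ℕ} {u v : V}
    (h : G.edist u v ≤ r) : ∃ p : G.Walk u v, p.length ≤ r := by
  obtain ⟨p, hp⟩ := (reachable_of_edist_ne_top
    (ne_top_of_le_ne_top (ENat.natCast_ne_top r) h)).exists_walk_length_eq_edist
  exact ⟨p, by exact_mod_cast hp ▸ h⟩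

lemma isShallowMinor_completeGraph_iff {V : Type*} {G : SimpleGraph V} {r t : ℕ} :
    IsShallowMinor r (completeGraph (Fin t)) G ↔ G.HasCliqueMinor r t := by
  constructor
  · rintro ⟨B, hconn, hrad, hdisj, hadj⟩
    have hc : ∀ i, ∃ c : (B i).verts, (B i).coe.eccent c ≤ r := fun i => by
      have : Nonempty (B i).verts := (hconn i).nonempty.to_subtype
      obtain ⟨c, hc⟩ := (B i).coe.exists_eccent_eq_radius
      exact ⟨c, hc ▸ hrad i⟩
    choose c hc using hc
    refine ⟨fun i => c i, fun i => (B i).verts, fun i => (c i).2, fun i v hv => ?_, hdisj,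
      fun i j hij => hadj i j hij.ne⟩
    obtain ⟨p, hp⟩ := exists_walk_length_le_of_edist_le ((eccent_le_iff _ _).1 (hc i) ⟨v, hv⟩)
    exact ((B i).within_of_coe_walk p).mono subset_rfl hp
  · rintro ⟨c, B, hcB, hB, hdisj, hadj⟩
    have hwalk : ∀ i (v : V) (hv : v ∈ B i), ∃ p : ((⊤ : G.Subgraph).induce (B i)).coe.Walk
        ⟨c i, hcB i⟩ ⟨v, hv⟩, p.length ≤ r := fun i v hv =>
      Subgraph.exists_coe_walk_of_within _ (U := B i) (by simp)
        (fun x hx y hy hxy => by simp [hx, hy, hxy]) (hB i v hv)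
    refine ⟨fun i => (⊤ : G.Subgraph).induce (B i), fun i => ?_, fun i => ?_,
      fun i j hij => hdisj i j hij, fun i j hij => HasCliqueMinor.exists_adj hadj i j hij⟩
    · rw [Subgraph.connected_iff']
      refine connected_iff_exists_forall_reachable _ |>.2 ⟨⟨c i, hcB i⟩, fun v => ?_⟩
      obtain ⟨p, -⟩ := hwalk i v v.2
      exact ⟨p⟩
    · refine (radius_le_eccent (u := ⟨c i, hcB i⟩)).trans ((eccent_le_iff _ _).2 fun v => ?_)
      obtain ⟨p, hp⟩ := hwalk i v v.2
      exact (edist_le p).trans (by exact_mod_cast hp)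

/-! ### Ramsey's theorem and a counting argument for independent families. -/

/-- Ramsey's theorem for symmetric relations. -/
theorem exists_ramsey (a b : ℕ) : ∃ N : ℕ, ∀ {α : Type u} (r : α → α → Prop),
    (∀ x y, r x y → r y x) → ∀ A : Finset α, N ≤ A.card →
      (∃ B ⊆ A, B.card = a ∧ ∀ x ∈ B, ∀ y ∈ B, x ≠ y → r x y) ∨
      (∃ B ⊆ A, B.card = b ∧ ∀ x ∈ B, ∀ y ∈ B, x ≠ y → ¬ r x y) := by
  classical
  induction a generalizing b with
  | zero => exact ⟨0, fun {α} r _ A _ => Or.inl ⟨∅, by simp⟩⟩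
  | succ a iha =>
    induction b with
    | zero => exact ⟨0, fun {α} r _ A _ => Or.inr ⟨∅, by simp⟩⟩
    | succ b ihb =>
      obtain ⟨N₁, h₁⟩ := iha (b + 1)
      obtain ⟨N₂, h₂⟩ := ihb
      refine ⟨N₁ + N₂ + 1, fun {α} r hr A hA => ?_⟩
      obtain ⟨x, hx⟩ : A.Nonempty := Finset.card_pos.1 (by omega)
      have hcard : ((A.erase x).filter (r x)).card + ((A.erase x).filter (¬ r x ·)).card + 1
          = A.card := by
        rw [Finset.card_filter_add_card_filter_not, Finset.card_erase_add_one hx]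
      have hsub : ∀ (P : α → Prop) [DecidablePred P], (A.erase x).filter P ⊆ A := fun P _ =>
        (Finset.filter_subset _ _).trans (Finset.erase_subset _ _)
      by_cases h : N₁ ≤ ((A.erase x).filter (r x)).card
      · rcases h₁ r hr _ h with ⟨B, hB, hBa, hBr⟩ | ⟨B, hB, hBb⟩
        · refine Or.inl ⟨insert x B, Finset.insert_subset hx (hB.trans (hsub _)), ?_, ?_⟩
          · rw [Finset.card_insert_of_notMem, hBa]
            exact fun h => by simpa using hB h
          · have hxB : ∀ y ∈ B, r x y := fun y hy => (Finset.mem_filter.1 (hB hy)).2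
            intro y hy z hz hyz
            rcases Finset.mem_insert.1 hy with rfl | hy' <;>
            rcases Finset.mem_insert.1 hz with rfl | hz'
            · exact absurd rfl hyz
            · exact hxB z hz'
            · exact hr _ _ (hxB y hy')
            · exact hBr y hy' z hz' hyz
        · exact Or.inr ⟨B, hB.trans (hsub _), hBb⟩
      · rcases h₂ r hr ((A.erase x).filter (¬ r x ·)) (by omega) with
          ⟨B, hB, hBa⟩ | ⟨B, hB, hBb, hBr⟩
        · exact Or.inl ⟨B, hB.trans (hsub _), hBa⟩
        · refine Or.inr ⟨insert x B, Finset.insert_subset hx (hB.trans (hsub _)), ?_, ?_⟩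
          · rw [Finset.card_insert_of_notMem, hBb]
            exact fun h => by simpa using hB h
          · have hxB : ∀ y ∈ B, ¬ r x y := fun y hy => (Finset.mem_filter.1 (hB hy)).2
            intro y hy z hz hyz
            rcases Finset.mem_insert.1 hy with rfl | hy' <;>
            rcases Finset.mem_insert.1 hz with rfl | hz'
            · exact absurd rfl hyz
            · exact hxB z hz'
            · exact fun h => hxB y hy' (hr _ _ h)
            · exact hBr y hy' z hz' hyz

/-- Forget the coordinate `a`: the coordinates `b` and `c` survive, so they determine a set of at
most `d` values for the forgotten one. -/
lemma card_filter_apply_mem_le {α : Type*} [DecidableEq α] (K : Finset α)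
    (F : α → α → Finset α) (n d : ℕ) (hd : ∀ x y, (F x y).card ≤ d) (a b c : Fin (n + 1))
    (hab : a ≠ b) (hac : a ≠ c) :
    ((Fintype.piFinset fun _ : Fin (n + 1) => K).filter fun f => f a ∈ F (f b) (f c)).card
      ≤ d * K.card ^ n := by
  obtain ⟨b', rfl⟩ := Fin.exists_succAbove_eq hab.symm
  obtain ⟨c', rfl⟩ := Fin.exists_succAbove_eq hac.symm
  have hcard : (Fintype.piFinset fun _ : Fin n => K).card = K.card ^ n := by simp
  rw [← hcard]
  refine Finset.card_le_mul_card_image_of_maps_to (f := fun f i => f (a.succAbove i))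
    (fun f hf => ?_) d fun g _ => ?_
  · simp only [Finset.mem_filter, Fintype.mem_piFinset] at hf ⊢
    exact fun i => hf.1 _
  · refine (Finset.card_le_card_of_injOn (fun f => f a) (fun f hf => ?_) ?_).trans
      (hd (g b') (g c'))
    · simp only [Finset.coe_filter, Finset.mem_filter, Set.mem_ofPred_eq] at hf
      rw [← hf.2]
      exact hf.1.2
    · intro f hf f' hf' h
      simp only [Finset.coe_filter, Finset.mem_filter, Set.mem_ofPred_eq] at hf hf'
      funext i
      by_cases hi : i = a
      · rw [hi]; exact h
      · obtain ⟨i', rfl⟩ := Fin.exists_succAbove_eq hi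
        exact congrFun (hf.2.trans hf'.2.symm) i'

/-- If all `F x y` are small compared to `K`, then `K` contains a family indexed by `Fin n` none of
whose members lies in an `F`-value of two other members. -/
theorem exists_forall_notMem_of_card_le {α : Type*} (K : Finset α) (F : α → α → Finset α)
    (n d : ℕ) (hd : ∀ x y, (F x y).card ≤ d) (hK : n ^ 3 * d < K.card) :
    ∃ f : Fin n → α, (∀ a, f a ∈ K) ∧
      ∀ a b c, a ≠ b → a ≠ c → f a ∉ F (f b) (f c) := by
  classical
  cases n with
  | zero => exact ⟨Fin.elim0, fun a => a.elim0, fun a => a.elim0⟩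
  | succ n =>
  by_contra! hcon
  -- Union bound: the bad events of the `(n + 1) ^ 3` index triples would have to cover all
  -- functions into `K`, but they are too few.
  let bad : Fin (n + 1) × Fin (n + 1) × Fin (n + 1) → Finset (Fin (n + 1) → α) := fun p =>
    if p.1 ≠ p.2.1 ∧ p.1 ≠ p.2.2 then
      (Fintype.piFinset fun _ => K).filter fun f => f p.1 ∈ F (f p.2.1) (f p.2.2) else ∅
  have hsub : (Fintype.piFinset fun _ : Fin (n + 1) => K) ⊆ Finset.univ.biUnion bad := by
    intro f hf
    obtain ⟨a, b, c, hab, hac, h⟩ := hcon f (Fintype.mem_piFinset.1 hf)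
    refine Finset.mem_biUnion.2 ⟨(a, b, c), Finset.mem_univ _, ?_⟩
    simp only [bad]
    rw [if_pos ⟨hab, hac⟩, Finset.mem_filter]
    exact ⟨hf, h⟩
  have hbad : ∀ p ∈ Finset.univ, (bad p).card ≤ d * K.card ^ n := by
    rintro ⟨a, b, c⟩ -
    simp only [bad]
    split_ifs with h
    · exact card_filter_apply_mem_le K F n d hd a b c h.1 h.2
    · simp
  have h1 := (Finset.card_le_card hsub).trans (Finset.card_biUnion_le_card_mul _ _ _ hbad)
  simp only [Fintype.card_piFinset_const, Finset.card_univ, Fintype.card_prod,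
    Fintype.card_fin] at h1
  have hpos : 0 < K.card ^ n := pow_pos (by omega) _
  have h2 : (n + 1) ^ 3 * d * K.card ^ n < K.card * K.card ^ n :=
    Nat.mul_lt_mul_of_pos_right hK hpos
  rw [pow_succ] at h1
  nlinarith

end SimpleGraph

/-! ### Uniform quasi-wideness. -/

namespace SimpleGraph

/-- The vertices of `B` avoid `S` and are pairwise at distance more than `R` in `G - S`. -/
def Scattered {V : Type*} (G : SimpleGraph V) (S : Finset V) (R : ℕ) (B : Finset V) : Prop :=
  (∀ b ∈ B, b ∉ S) ∧ ∀ b ∈ B, ∀ b' ∈ B, b ≠ b' → ¬ G.Within (↑S)ᶜ R b b'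

lemma Scattered.subset {V : Type*} {G : SimpleGraph V} {S : Finset V} {R : ℕ} {B B' : Finset V}
    (h : G.Scattered S R B) (hB : B' ⊆ B) : G.Scattered S R B' :=
  ⟨fun b hb => h.1 b (hB hb), fun b hb b' hb' => h.2 b (hB hb) b' (hB hb')⟩

lemma Scattered.eq_of_within {V : Type*} {G : SimpleGraph V} {S : Finset V} {R i j : ℕ}
    {B : Finset V} (h : G.Scattered S R B) {b b' w : V} (hb : b ∈ B) (hb' : b' ∈ B)
    (hw : G.Within (↑S)ᶜ i b w) (hw' : G.Within (↑S)ᶜ j b' w) (hij : i + j ≤ R) : b = b' := by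
  by_contra hne
  exact h.2 b hb b' hb' hne ((hw.trans hw'.symm).mono subset_rfl hij)

/-- The `i`-balls around the scattered vertices are disjoint, and two centers at distance `2 * i +
1` have adjacent balls. By Ramsey, either `t` such balls form a clique minor or many centers are
farther apart. -/
theorem exists_scattered_odd (t i m : ℕ) : ∃ N : ℕ, ∀ {V : Type u} (G : SimpleGraph V),
    ¬ G.HasCliqueMinor i t → ∀ S B : Finset V, G.Scattered S (2 * i) B → N ≤ B.card →
      ∃ B' ⊆ B, m ≤ B'.card ∧ G.Scattered S (2 * i + 1) B' := by
  obtain ⟨N, hN⟩ := exists_ramsey.{u} t m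
  refine ⟨N, fun {V} G hG S B hS hB => ?_⟩
  rcases hN (fun b b' => G.Within (↑S)ᶜ (2 * i + 1) b b') (fun _ _ h => h.symm) B hB with
    ⟨B', hB', hcard, hr⟩ | ⟨B', hB', hcard, hr⟩
  · refine absurd ?_ hG
    let e := B'.equivFinOfCardEq hcard
    have hmem : ∀ a, (e.symm a : V) ∈ B := fun a => hB' (e.symm a).2
    have hinj : ∀ a b, a ≠ b → (e.symm a : V) ≠ e.symm b := fun a b hab h =>
      hab (e.symm.injective (Subtype.ext h))
    refine ⟨fun a => e.symm a, fun a => {w | G.Within (↑S)ᶜ i (e.symm a) w},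
      fun a => .refl (hS.1 _ (hmem a)), fun a v hv => hv.within_ball, fun a b hab => ?_,
      fun a b hab => ?_⟩
    · rw [Set.disjoint_left]
      exact fun w hw hw' => hinj a b hab (hS.eq_of_within (hmem a) (hmem b) hw hw' (by omega))
    · have h := hr _ (e.symm a).2 _ (e.symm b).2 (hinj a b hab.ne)
      rw [show 2 * i + 1 = (i + 1) + i by ring] at h
      obtain ⟨w, hw, hw'⟩ := h.split
      obtain ⟨x, hx, rfl | hxw⟩ := hw.exists_last
      · exact absurd (hS.eq_of_within (hmem a) (hmem b) hx hw'.symm (by omega)) (hinj a b hab.ne)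
      · exact ⟨x, hx, w, hw'.symm, hxw⟩
  · exact ⟨B', hB', hcard.ge, fun b hb => hS.1 b (hB' hb), hr⟩

/-- If each vertex outside `S` is close to few vertices of a scattered set, a large part of the
set is scattered at the next distance. -/
theorem exists_scattered_even_of_bounded (t i m d : ℕ) : ∃ N : ℕ, ∀ {V : Type u}
    (G : SimpleGraph V), ¬ G.HasCliqueMinor (i + 1) t → ∀ S B : Finset V,
    G.Scattered S (2 * i + 1) B →
    (∀ w, ∀ D ⊆ B, (∀ b ∈ D, G.Within (↑S)ᶜ (i + 1) b w) → D.card ≤ d) → N ≤ B.card →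
      ∃ B' ⊆ B, m ≤ B'.card ∧ G.Scattered S (2 * i + 2) B' := by
  classical
  obtain ⟨N, hN⟩ := exists_ramsey.{u} (t ^ 3 * (d + 1) + 1) m
  refine ⟨N, fun {V} G hG S B hS hd hB => ?_⟩
  rcases hN (fun b b' => G.Within (↑S)ᶜ (2 * i + 2) b b') (fun _ _ h => h.symm) B hB with
    ⟨K, hK, hcard, hr⟩ | ⟨B', hB', hcard, hr⟩
  · refine absurd ?_ hG
    -- Two centers at distance `2 * i + 2` have a midpoint outside both `i`-balls, adjacent to each
    -- ball.
    have hmid : ∀ x y : V, ∃ w, x ∈ K → y ∈ K → x ≠ y →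
        G.Within (↑S)ᶜ (i + 1) x w ∧ G.Within (↑S)ᶜ (i + 1) y w := by
      intro x y
      by_cases h : x ∈ K ∧ y ∈ K ∧ x ≠ y
      · obtain ⟨w, hw, hw'⟩ := ((hr x h.1 y h.2.1 h.2.2).mono subset_rfl
          (show 2 * i + 2 ≤ (i + 1) + (i + 1) by omega)).split
        exact ⟨w, fun _ _ _ => ⟨hw, hw'.symm⟩⟩
      · exact ⟨x, fun h1 h2 h3 => absurd ⟨h1, h2, h3⟩ h⟩
    choose mid hmid using hmid
    -- Avoiding `F` makes each chosen midpoint touch only its own two balls; `x` is inserted so that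
    -- the choice is also injective.
    let F : V → V → Finset V := fun x y =>
      insert x (K.filter fun b => G.Within (↑S)ᶜ (i + 1) b (mid x y))
    have hF : ∀ x y, (F x y).card ≤ d + 1 := fun x y =>
      (Finset.card_insert_le _ _).trans (Nat.succ_le_succ (hd (mid x y) _
        ((Finset.filter_subset _ _).trans hK) fun b hb => (Finset.mem_filter.1 hb).2))
    obtain ⟨f, hfK, hf⟩ := exists_forall_notMem_of_card_le K F t (d + 1) hF (by omega)
    have hinj : ∀ a b, a ≠ b → f a ≠ f b := fun a b hab h =>
      hf a b b hab hab (h ▸ Finset.mem_insert_self _ _)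
    have htouch : ∀ a b, a ≠ b → G.Within (↑S)ᶜ (i + 1) (f a) (mid (f a) (f b)) ∧
        G.Within (↑S)ᶜ (i + 1) (f b) (mid (f a) (f b)) := fun a b hab =>
      hmid _ _ (hfK a) (hfK b) (hinj a b hab)
    have hfB : ∀ a, f a ∈ B := fun a => hK (hfK a)
    have honly : ∀ a b c, a ≠ b → G.Within (↑S)ᶜ (i + 1) (f c) (mid (f a) (f b)) →
        c = a ∨ c = b := by
      intro a b c hab hc
      by_contra! hne
      exact hf c a b hne.1 hne.2
        (Finset.mem_insert_of_mem (Finset.mem_filter.2 ⟨hfK c, hc⟩))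
    have hball : ∀ a b c, a ≠ b → ¬ G.Within (↑S)ᶜ i (f c) (mid (f a) (f b)) := by
      intro a b c hab hc
      have h1 := hS.eq_of_within (hfB c) (hfB a) hc (htouch a b hab).1 (by omega)
      have h2 := hS.eq_of_within (hfB c) (hfB b) hc (htouch a b hab).2 (by omega)
      exact hinj a b hab (h1.symm.trans h2)
    have hadj : ∀ a b c, a ≠ b → G.Within (↑S)ᶜ (i + 1) (f c) (mid (f a) (f b)) →
        ∃ x, G.Within (↑S)ᶜ i (f c) x ∧ G.Adj x (mid (f a) (f b)) := by
      intro a b c hab hc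
      obtain ⟨x, hx, rfl | hadj⟩ := hc.exists_last
      · exact absurd hx (hball a b c hab)
      · exact ⟨x, hx, hadj⟩
    -- Each midpoint joins the ball with the smaller index, so the branch sets stay disjoint and the
    -- radius grows by one only.
    refine ⟨f, fun a => {w | G.Within (↑S)ᶜ i (f a) w ∨ ∃ b, a < b ∧ w = mid (f a) (f b)},
      fun a => Or.inl (.refl (hS.1 _ (hfB a))), fun a v hv => ?_, fun a b hab => ?_,
      fun a b hab => ?_⟩
    · have hsub : {w | G.Within (↑S)ᶜ i (f a) w} ⊆
          {w | G.Within (↑S)ᶜ i (f a) w ∨ ∃ b, a < b ∧ w = mid (f a) (f b)} := fun w hw => Or.inl hw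
      rcases hv with hv | ⟨b, hab, rfl⟩
      · exact hv.within_ball.mono hsub (by omega)
      · obtain ⟨x, hx, hadj⟩ := hadj a b a hab.ne (htouch a b hab.ne).1
        exact (hx.within_ball.mono hsub le_rfl).trans
          (.of_adj hadj (Or.inl hx) (Or.inr ⟨b, hab, rfl⟩))
    · rw [Set.disjoint_left]
      rintro w (hw | ⟨c, hac, rfl⟩) (hw' | ⟨c', hbc, hw'⟩)
      · exact hinj a b hab (hS.eq_of_within (hfB a) (hfB b) hw hw' (by omega))
      · exact hball b c' a hbc.ne (hw' ▸ hw)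
      · exact hball a c b hac.ne hw'
      · have h1 := honly a c b hac.ne (hw' ▸ (htouch b c' hbc.ne).1)
        have h2 := honly a c c' hac.ne (hw' ▸ (htouch b c' hbc.ne).2)
        omega
    · obtain ⟨x, hx, hadj⟩ := hadj a b b hab.ne (htouch a b hab.ne).2
      exact ⟨_, Or.inr ⟨b, hab, rfl⟩, x, Or.inl hx, hadj.symm⟩
  · exact ⟨B', hB', hcard.ge, fun b hb => hS.1 b (hB' hb), hr⟩

/-- Many balls all adjacent to the same vertices outside give a clique minor. -/
lemma hasCliqueMinor_of_touch {V : Type*} {G : SimpleGraph V} {t i : ℕ} {S W B : Finset V}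
    (hS : G.Scattered S (2 * i + 1) B) (hW : t ≤ W.card) (hB : t ≤ B.card) (hB2 : 2 ≤ B.card)
    (h : ∀ b ∈ B, ∀ w ∈ W, G.Within (↑S)ᶜ (i + 1) b w) : G.HasCliqueMinor (i + 1) t := by
  classical
  obtain ⟨W', hW', hWc⟩ := Finset.exists_subset_card_eq hW
  obtain ⟨B', hB', hBc⟩ := Finset.exists_subset_card_eq hB
  let e := W'.equivFinOfCardEq hWc
  let g := B'.equivFinOfCardEq hBc
  have hgB : ∀ a, (g.symm a : V) ∈ B := fun a => hB' (g.symm a).2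
  have heW : ∀ a, (e.symm a : V) ∈ W := fun a => hW' (e.symm a).2
  have hg : ∀ a b, a ≠ b → (g.symm a : V) ≠ g.symm b := fun a b hab h =>
    hab (g.symm.injective (Subtype.ext h))
  have he : ∀ a b, a ≠ b → (e.symm a : V) ≠ e.symm b := fun a b hab h =>
    hab (e.symm.injective (Subtype.ext h))
  have hball : ∀ b ∈ B, ∀ w ∈ W, ¬ G.Within (↑S)ᶜ i b w := by
    intro b hb w hw hbw
    obtain ⟨b', hb', hne⟩ := Finset.exists_mem_ne (show 1 < B.card by omega) b
    exact hne (hS.eq_of_within hb hb' hbw (h b' hb' w hw) (by omega)).symm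
  have hadj : ∀ b ∈ B, ∀ w ∈ W, ∃ x, G.Within (↑S)ᶜ i b x ∧ G.Adj x w := by
    intro b hb w hw
    obtain ⟨x, hx, rfl | hadj⟩ := (h b hb w hw).exists_last
    · exact absurd hx (hball b hb x hw)
    · exact ⟨x, hx, hadj⟩
  refine ⟨fun a => g.symm a, fun a => {w | G.Within (↑S)ᶜ i (g.symm a) w ∨ w = e.symm a},
      fun a => Or.inl (.refl (hS.1 _ (hgB a))), fun a v hv => ?_, fun a b hab => ?_,
      fun a b hab => ?_⟩
  · have hsub : {w | G.Within (↑S)ᶜ i (g.symm a) w} ⊆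
      {w | G.Within (↑S)ᶜ i (g.symm a) w ∨ w = e.symm a} := fun w hw => Or.inl hw
    rcases hv with hv | rfl
    · exact hv.within_ball.mono hsub (by omega)
    · obtain ⟨x, hx, hadj⟩ := hadj _ (hgB a) _ (heW a)
      exact (hx.within_ball.mono hsub le_rfl).trans (.of_adj hadj (Or.inl hx) (Or.inr rfl))
  · rw [Set.disjoint_left]
    rintro w (hw | rfl) (hw' | hw')
    · exact hg a b hab (hS.eq_of_within (hgB a) (hgB b) hw hw' (by omega))
    · exact hball _ (hgB a) _ (heW b) (hw' ▸ hw)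
    · exact hball _ (hgB b) _ (heW a) hw'
    · exact he a b hab hw'
  · obtain ⟨x, hx, hadj⟩ := hadj _ (hgB b) _ (heW a)
    exact ⟨_, Or.inr rfl, x, Or.inl hx, hadj.symm⟩

/-- Collect hubs: as long as some new vertex touches many of the current balls, add it to `W` and
keep only those balls. Fewer than `t` hubs can be collected, as `t` hubs paired with `t` balls give
a clique minor. Once no new hub exists, deleting `W` as well leads to the bounded case. -/
theorem exists_scattered_even (t i m : ℕ) : ∃ N : ℕ, ∀ {V : Type u} (G : SimpleGraph V),
    ¬ G.HasCliqueMinor (i + 1) t → ∀ S B : Finset V, G.Scattered S (2 * i + 1) B → N ≤ B.card →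
      ∃ S' : Finset V, S'.card ≤ S.card + t ∧
      ∃ B' ⊆ B, m ≤ B'.card ∧ G.Scattered S' (2 * i + 2) B' := by
  classical
  suffices H : ∀ j, ∃ N : ℕ, ∀ {V : Type u} (G : SimpleGraph V),
      ¬ G.HasCliqueMinor (i + 1) t → ∀ S B W : Finset V, G.Scattered S (2 * i + 1) B →
      t ≤ W.card + j → W.card ≤ t → (∀ b ∈ B, ∀ w ∈ W, G.Within (↑S)ᶜ (i + 1) b w) →
      N ≤ B.card → ∃ S' : Finset V, S'.card ≤ S.card + t ∧
        ∃ B' ⊆ B, m ≤ B'.card ∧ G.Scattered S' (2 * i + 2) B' by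
    obtain ⟨N, hN⟩ := H t
    exact ⟨N, fun G hG S B hS hB => hN G hG S B ∅ hS (by simp) (by simp) (by simp) hB⟩
  -- Here `j` bounds the number of hubs still missing from `W`.
  intro j
  induction j with
  | zero =>
    refine ⟨t + 2, fun G hG S B W hS hW _ h hB => absurd ?_ hG⟩
    exact hasCliqueMinor_of_touch hS (by omega) (by omega) (by omega) h
  | succ j ih =>
    obtain ⟨N₁, h₁⟩ := ih
    obtain ⟨N₂, h₂⟩ := exists_scattered_even_of_bounded.{u} t i m N₁
    refine ⟨N₂ + t + 2, fun {V} G hG S B W hS hW hWt h hB => ?_⟩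
    have hWt' : W.card < t := by
      by_contra! hlt
      exact hG (hasCliqueMinor_of_touch hS hlt (by omega) (by omega) h)
    by_cases hex : ∃ w ∉ W, N₁ ≤ (B.filter fun b => G.Within (↑S)ᶜ (i + 1) b w).card
    · obtain ⟨w, hwW, hw⟩ := hex
      obtain ⟨S', hS', B', hB', h'⟩ := h₁ G hG S _ (insert w W)
        (hS.subset (Finset.filter_subset _ _))
        (by rw [Finset.card_insert_of_notMem hwW]; omega)
        (by rw [Finset.card_insert_of_notMem hwW]; omega)
        (fun b hb x hx => by
          rcases Finset.mem_insert.1 hx with rfl | hx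
          · exact (Finset.mem_filter.1 hb).2
          · exact h b (Finset.mem_filter.1 hb).1 x hx) hw
      exact ⟨S', hS', B', hB'.trans (Finset.filter_subset _ _), h'⟩
    · push Not at hex
      have hsub : ((↑(S ∪ W) : Set V))ᶜ ⊆ (↑S)ᶜ := by
        simp
      have hSW : G.Scattered (S ∪ W) (2 * i + 1) B := by
        refine ⟨fun b hb hbSW => ?_, fun b hb b' hb' hne hw =>
          hS.2 b hb b' hb' hne (hw.mono hsub le_rfl)⟩
        rcases Finset.mem_union.1 hbSW with hbS | hbW
        · exact hS.1 b hb hbS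
        · obtain ⟨b', hb', hne⟩ := Finset.exists_mem_ne (show 1 < B.card by omega) b
          exact hS.2 b' hb' b hb hne ((h b' hb' b hbW).mono subset_rfl (by omega))
      obtain ⟨B', hB', h'⟩ := h₂ G hG (S ∪ W) B hSW (fun w D hD hw => by
        by_cases hwW : w ∈ W
        · rcases D.eq_empty_or_nonempty with rfl | ⟨b, hb⟩
          · simp
          · exact absurd (hw b hb).mem_right (by simp [hwW])
        · exact (Finset.card_le_card fun b hb => Finset.mem_filter.2
            ⟨hD hb, (hw b hb).mono hsub le_rfl⟩).trans (hex w hwW).le) (by omega)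
      exact ⟨S ∪ W, (Finset.card_union_le _ _).trans (by omega), B', hB', h'⟩

end SimpleGraph

/-- Nowhere dense classes are uniformly quasi-wide. -/
theorem NowhereDense.exists_scattered {C : Set FinGraph.{u}} (hC : NowhereDense C) (i : ℕ) :
    ∃ s : ℕ, ∀ m : ℕ, ∃ N : ℕ, ∀ G ∈ C, ∀ A : Finset G.V, N ≤ A.card →
      ∃ S : Finset G.V, S.card ≤ s ∧ ∃ B ⊆ A, m ≤ B.card ∧ G.graph.Scattered S (2 * i) B := by
  induction i with
  | zero =>
    refine ⟨0, fun m => ⟨m, fun G _ A hA => ⟨∅, by simp, A, subset_rfl, hA, by simp, ?_⟩⟩⟩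
    exact fun b _ b' _ hne h => hne h.eq_of_zero
  | succ i ih =>
    obtain ⟨s, hs⟩ := ih
    obtain ⟨t, ht⟩ := hC (i + 1)
    simp only [SimpleGraph.isShallowMinor_completeGraph_iff] at ht
    -- The bound on the deleted set is fixed before `m`; the choice `m = 2 * (s + 1)` made later
    -- depends on this.
    refine ⟨s + t, fun m => ?_⟩
    obtain ⟨N₂, h₂⟩ := SimpleGraph.exists_scattered_even.{u} t i m
    obtain ⟨N₁, h₁⟩ := SimpleGraph.exists_scattered_odd.{u} t i N₂
    obtain ⟨N, hN⟩ := hs N₁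
    refine ⟨N, fun G hG A hA => ?_⟩
    obtain ⟨S, hS, B, hBA, hB, hSB⟩ := hN G hG A hA
    obtain ⟨B₁, hB₁, hc₁, hS₁⟩ := h₁ G.graph
      (fun h => ht G hG (h.mono (by omega) le_rfl)) S B hSB hB
    obtain ⟨S', hS', B₂, hB₂, hc₂, hS₂⟩ := h₂ G.graph (ht G hG) S B₁ hS₁ hc₁
    exact ⟨S', hS'.trans (by omega), B₂, hB₂.trans (hB₁.trans hBA), hc₂, hS₂⟩

/-! ### Histories, distance profiles and the branching process. -/

namespace SimpleGraph

/-- `History G R L T`: the list `L` (latest entry first) records vertices `v` together with the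
vertex set `S` held just before `v` was added; `T` is the current vertex set. Short walks between
recorded vertices avoiding the earlier set have been included in the later sets. -/
inductive History {V : Type*} (G : SimpleGraph V) (R : ℕ) :
    List (V × Finset V) → Finset V → Prop
  | nil (T : Finset V) : History G R [] T
  | cons {L : List (V × Finset V)} {S T : Finset V} {v : V} : History G R L S → S ⊆ T → v ∈ T →
      (∀ p ∈ L, G.Within (↑p.2)ᶜ R p.1 v → G.Within ((↑p.2)ᶜ ∩ ↑T) R p.1 v) →
      History G R ((v, S) :: L) T

namespace History

variable {V : Type*} {G : SimpleGraph V} {R : ℕ} {L L' : List (V × Finset V)} {S T T' : Finset V}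

lemma mono (h : G.History R L T) (hT : T ⊆ T') : G.History R L T' := by
  cases h with
  | nil => exact .nil _
  | cons hL hS hv hw =>
    exact .cons hL (hS.trans hT) (hT hv) fun p hp h =>
      (hw p hp h).mono (Set.inter_subset_inter_right _ (by exact_mod_cast hT)) le_rfl

lemma sublist (h : G.History R L T) (hL : L'.Sublist L) : G.History R L' T := by
  induction h generalizing L' with
  | nil => rw [List.sublist_nil.1 hL]; exact .nil _
  | cons hL' hS hv hw ih =>
    cases hL with
    | cons _ h => exact (ih h).mono hS
    | cons_cons _ h => exact .cons (ih h) hS hv fun p hp => hw p (h.subset hp)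

lemma subset (h : G.History R L T) {p : V × Finset V} (hp : p ∈ L) : p.2 ⊆ T ∧ p.1 ∈ T := by
  induction h with
  | nil => simp at hp
  | cons hL' hS hv hw ih =>
    rcases List.mem_cons.1 hp with rfl | hp
    · exact ⟨hS, hv⟩
    · exact ⟨(ih hp).1.trans hS, hS (ih hp).2⟩

/-- Every earlier vertex belongs to the set held when a later one is recorded. -/
lemma nodup (h : G.History R L T) (hL : ∀ p ∈ L, p.1 ∉ p.2) : (L.map Prod.fst).Nodup := by
  induction h with
  | nil => simp
  | cons hL' hS hv hw ih =>
    rw [List.map_cons, List.nodup_cons]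
    refine ⟨fun hmem => ?_, ih fun p hp => hL p (List.mem_cons_of_mem _ hp)⟩
    obtain ⟨p, hp, hpv⟩ := List.mem_map.1 hmem
    exact hL _ List.mem_cons_self (hpv ▸ (hL'.subset hp).2)

/-- A set separating the vertices of a history meets many disjoint walks. -/
lemma le_card_inter [DecidableEq V] {r : ℕ} {x : V} {A : Finset V} (a : ℕ)
    (h : G.History (r + r) L T)
    (hx : ∀ p ∈ L, G.Within (↑p.2)ᶜ r p.1 x) (hA : G.Scattered A (r + r) (L.map Prod.fst).toFinset)
    (hL : 2 * a ≤ L.length) : a ≤ (A ∩ T).card := by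
  induction a generalizing L T with
  | zero => simp
  | succ a ih =>
    have hnodup := h.nodup fun p hp => by simpa using (hx p hp).mem_left
    rcases L with _ | ⟨⟨v, S⟩, _ | ⟨⟨w, S'⟩, L⟩⟩
    · simp at hL
    · simp only [List.length_cons, List.length_nil] at hL
      omega
    · obtain _ | ⟨h', hS, hv, hw⟩ := h
      obtain _ | ⟨h', hS', hv', hw'⟩ := h'
      -- The two latest vertices are joined through `x` by a walk avoiding the older set `S'`, so
      -- the history stores one inside `T \ S'`. Scatteredness makes `A` hit it outside `S'`, and
      -- induction counts the hits inside `S'`.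
      have hpq := hw (w, S') (by simp) (((hx (w, S') (by simp)).trans ((hx (v, S) (by simp)).mono
        (Set.compl_subset_compl.2 (by exact_mod_cast hS')) le_rfl).symm))
      obtain ⟨P, hP, hPs⟩ := hpq
      have hhit : ∃ z ∈ P.support, z ∈ A := by
        by_contra! hno
        refine hA.2 _ (by simp) _ (by simp) ?_ ⟨P, hP, fun z hz => by simpa using hno z hz⟩
        intro heq
        simp only [List.map_cons, List.nodup_cons, List.mem_cons] at hnodup
        exact hnodup.1 (Or.inl heq.symm)
      obtain ⟨z, hz, hzA⟩ := hhit
      obtain ⟨hz1, hz2⟩ := hPs z hz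
      have ih' := ih h' (fun p hp => hx p (by simp [hp])) (hA.subset (by
        intro y; simp only [List.map_cons, List.toFinset_cons, Finset.mem_insert]; tauto))
        (by simp at hL; omega)
      have hsub : insert z (A ∩ S') ⊆ A ∩ T :=
        Finset.insert_subset (Finset.mem_inter.2 ⟨hzA, hz2⟩)
          (Finset.inter_subset_inter_left (hS'.trans hS))
      have hzn : z ∉ A ∩ S' := fun hz' => hz1 (Finset.mem_inter.1 hz').2
      have := Finset.card_le_card hsub
      rw [Finset.card_insert_of_notMem hzn] at this
      omega

end History

/-- The bounds `d ≤ r` for which some vertex of `X` is at distance at most `d` from `s`. -/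
def distProfile {V : Type*} (G : SimpleGraph V) (r : ℕ) (X : Set V) (s : V) : Set (Fin (r + 1)) :=
  {d | ∃ x ∈ X, G.Within Set.univ d s x}

/-- Cut the walk at its vertex `q ∈ T` and replace the tail by one to `Y` that is no longer; the
profile at `q` provides it. -/
lemma Captures.congr {V : Type*} {G : SimpleGraph V} {r : ℕ} {T X Y : Set V} {a : V}
    (h : G.Captures r T X a) (hXY : ∀ s ∈ T, G.distProfile r X s = G.distProfile r Y s) :
    G.Captures r T Y a := by
  classical
  obtain ⟨x, hx, p, hp, q, hq, hqp⟩ := h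
  have hlen : (p.takeUntil q hqp).length + (p.dropUntil q hqp).length = p.length := by
    rw [← Walk.length_append, Walk.take_spec]
  have hmem : (⟨(p.dropUntil q hqp).length, by omega⟩ : Fin (r + 1)) ∈ G.distProfile r X q :=
    ⟨x, hx, p.dropUntil q hqp, le_rfl, by simp⟩
  rw [hXY q hq] at hmem
  obtain ⟨y, hy, P, hP, -⟩ := hmem
  simp only at hP
  refine ⟨y, hy, (p.takeUntil q hqp).append P, ?_, q, hq, ?_⟩
  · rw [Walk.length_append]; omega
  · rw [Walk.mem_support_append_iff]; right; exact P.start_mem_support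

lemma Captures.mono {V : Type*} {G : SimpleGraph V} {r : ℕ} {T T' X : Set V} {a : V}
    (h : G.Captures r T X a) (hT : T ⊆ T') : G.Captures r T' X a := by
  obtain ⟨x, hx, p, hp, q, hq, hqp⟩ := h
  exact ⟨x, hx, p, hp, q, hT hq, hqp⟩

lemma History.exists_extend {V : Type*} {G : SimpleGraph V} {R : ℕ} {L : List (V × Finset V)}
    {S : Finset V} (h : G.History R L S) (v : V) :
    ∃ T : Finset V, S ⊆ T ∧ T.card ≤ S.card + 1 + L.length * (R + 1) ∧
      G.History R ((v, S) :: L) T := by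
  classical
  have key : ∀ M : List (V × Finset V), ∃ T : Finset V, T.card ≤ M.length * (R + 1) ∧
      ∀ p ∈ M, G.Within (↑p.2)ᶜ R p.1 v → G.Within ((↑p.2)ᶜ ∩ ↑T) R p.1 v := by
    intro M
    induction M with
    | nil => exact ⟨∅, by simp⟩
    | cons p M ih =>
      obtain ⟨T, hT, hM⟩ := ih
      by_cases hp : G.Within (↑p.2)ᶜ R p.1 v
      · obtain ⟨P, hP, hPs⟩ := hp
        refine ⟨T ∪ P.support.toFinset, ?_, fun q hq hw => ?_⟩
        · have h1 := Finset.card_union_le T P.support.toFinset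
          have h2 := P.support.toFinset_card_le
          rw [Walk.length_support] at h2
          rw [List.length_cons, add_mul]
          omega
        · rcases List.mem_cons.1 hq with rfl | hq
          · exact ⟨P, hP, fun w hw => ⟨hPs w hw, by simp [hw]⟩⟩
          · exact (hM q hq hw).mono (Set.inter_subset_inter_right _ (by simp)) le_rfl
      · refine ⟨T, hT.trans (by rw [List.length_cons, add_mul]; omega), fun q hq hw => ?_⟩
        rcases List.mem_cons.1 hq with rfl | hq
        · exact absurd hw hp
        · exact hM q hq hw
  obtain ⟨T, hT, hL⟩ := key L
  refine ⟨insert v S ∪ T, (Finset.subset_insert _ _).trans Finset.subset_union_left, ?_,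
    .cons h ((Finset.subset_insert _ _).trans Finset.subset_union_left) (by simp)
      fun p hp hw => (hL p hp hw).mono (Set.inter_subset_inter_right _
        (by exact_mod_cast Finset.subset_union_right)) le_rfl⟩
  have h1 := Finset.card_union_le (insert v S) T
  have h2 := Finset.card_insert_le v S
  omega

/-- `X` is a `k`-element set dominating `A`, and no recorded vertex was captured when recorded. -/
def Uncaptured {V : Type*} (G : SimpleGraph V) (k r : ℕ) (A : Set V) (L : List (V × Finset V))
    (X : Finset V) : Prop :=
  X.card = k ∧ A ⊆ G.neighborhoodWithin r X ∧ ∀ p ∈ L, p.1 ∈ A ∧ ¬ G.Captures r p.2 X p.1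

/-- If histories have bounded length, there are small sets capturing everything. -/
theorem exists_forall_captures (k r M n b : ℕ) : ∃ c : ℕ, ∀ {V : Type u} (G : SimpleGraph V)
    (A : Set V), (∀ L T X, G.History (r + r) L T → G.Uncaptured k r A L X → L.length < M) →
    ∀ L T, G.History (r + r) L T → T.card ≤ b → M ≤ L.length + n →
    ∀ D : Set (Finset V), (∀ X ∈ D, G.Uncaptured k r A L X) →
      (∀ X ∈ D, ∀ Y ∈ D, ∀ s ∈ T, G.distProfile r X s = G.distProfile r Y s) →
      ∃ Q : Finset V, Q.card ≤ c ∧ ∀ X ∈ D, ∀ a ∈ A, G.Captures r Q X a := by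
  classical
  induction n generalizing b with
  | zero =>
    refine ⟨0, fun G A hM L T hL _ hlen D hD _ => ⟨∅, by simp, fun X hX => ?_⟩⟩
    exact absurd (hM L T X hL (hD X hX)) (by omega)
  | succ n ih =>
    -- One step adds the new vertex and at most `M` walks with at most `r + r + 1` vertices each;
    -- the power of two counts the profiles on the enlarged set.
    obtain ⟨c, hc⟩ := ih (b + 1 + M * (r + r + 1))
    refine ⟨max b (2 ^ ((b + 1 + M * (r + r + 1)) * (r + 1)) * c),
      fun {V} G A hM L T hL hT hlen D hD hprof => ?_⟩
    by_cases hcap : ∀ X ∈ D, ∀ a ∈ A, G.Captures r T X a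
    · exact ⟨T, hT.trans (le_max_left _ _), hcap⟩
    · push Not at hcap
      obtain ⟨X₀, hX₀, a, ha, hXa⟩ := hcap
      obtain ⟨T', hTT', hcard, hL'⟩ := hL.exists_extend a
      have hLM := hM L T X₀ hL (hD X₀ hX₀)
      have hcard' : T'.card ≤ b + 1 + M * (r + r + 1) :=
        hcard.trans (Nat.add_le_add (by omega) (Nat.mul_le_mul_right _ hLM.le))
      have hunc : ∀ X ∈ D, G.Uncaptured k r A ((a, T) :: L) X := by
        intro X hX
        obtain ⟨h1, h2, h3⟩ := hD X hX
        refine ⟨h1, h2, fun p hp => ?_⟩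
        rcases List.mem_cons.1 hp with rfl | hp
        · exact ⟨ha, fun h => hXa (h.congr (hprof X hX X₀ hX₀))⟩
        · exact h3 p hp
      have hsub : ∀ τ : Set (T' × Fin (r + 1)), ∃ Q : Finset V, Q.card ≤ c ∧
          ∀ X ∈ D, {z : T' × Fin (r + 1) | z.2 ∈ G.distProfile r X z.1} = τ →
            ∀ a ∈ A, G.Captures r Q X a := by
        intro τ
        obtain ⟨Q, hQ, h⟩ := hc G A hM _ T' hL' hcard' (by rw [List.length_cons]; omega)
          {X | X ∈ D ∧ {z : T' × Fin (r + 1) | z.2 ∈ G.distProfile r X z.1} = τ}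
          (fun X hX => hunc X hX.1) (fun X hX Y hY s hs => by
            ext d
            have := hX.2.trans hY.2.symm
            exact Set.ext_iff.1 this (⟨s, hs⟩, d))
        exact ⟨Q, hQ, fun X hX hτ => h X ⟨hX, hτ⟩⟩
      choose Q hQ hcapQ using hsub
      refine ⟨Finset.univ.biUnion Q, ?_, fun X hX a ha => ?_⟩
      · refine (Finset.card_biUnion_le_card_mul _ _ c fun τ _ => hQ τ).trans
          (le_trans (Nat.mul_le_mul_right _ ?_) (le_max_right _ _))
        rw [Finset.card_univ, Fintype.card_set, Fintype.card_prod, Fintype.card_fin,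
          Fintype.card_coe]
        exact Nat.pow_le_pow_right (by norm_num) (Nat.mul_le_mul_right _ hcard')
      · exact (hcapQ _ X hX rfl a ha).mono (by
          exact_mod_cast Finset.subset_biUnion_of_mem Q (Finset.mem_univ _))

end SimpleGraph

open SimpleGraph

/-- Pigeonhole over the `k` elements of `X` gives a common target `x`, and quasi-wideness then
contradicts `History.le_card_inter`. -/
theorem NowhereDense.exists_history_length_lt {C : Set FinGraph.{u}} (hC : NowhereDense C)
    (r k : ℕ) : ∃ M : ℕ, ∀ G ∈ C, ∀ (A : Set G.V) L T X, G.graph.History (r + r) L T →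
      G.graph.Uncaptured k r A L X → L.length < M := by
  classical
  obtain ⟨s, hs⟩ := hC.exists_scattered r
  obtain ⟨N, hN⟩ := hs (2 * (s + 1))
  refine ⟨k * N + 1, fun G hG A L T X hL ⟨hXk, hAX, hunc⟩ => ?_⟩
  by_contra! hlen
  have hnear : ∀ p ∈ L, ∃ x ∈ X, G.graph.Within (↑p.2)ᶜ r p.1 x := by
    intro p hp
    obtain ⟨hpA, hcap⟩ := hunc p hp
    obtain ⟨x, hx, hpx⟩ := hAX hpA
    obtain ⟨P, hP⟩ := exists_walk_length_le_of_edist_le hpx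
    -- A walk meeting the earlier set would witness a capture.
    exact ⟨x, hx, P, hP, fun w hw hw' => hcap ⟨x, hx, P, hP, w, hw', hw⟩⟩
  have hnodup := hL.nodup fun p hp => by
    obtain ⟨x, -, h⟩ := hnear p hp
    simpa using h.mem_left
  have hpig : ∃ x ∈ X, N ≤ ((L.toFinset).filter
      fun p => G.graph.Within (↑p.2)ᶜ r p.1 x).card := by
    by_contra! hno
    have hsub : L.toFinset ⊆ X.biUnion fun x => (L.toFinset).filter
        fun p => G.graph.Within (↑p.2)ᶜ r p.1 x := by
      intro p hp
      obtain ⟨x, hx, h⟩ := hnear p (List.mem_toFinset.1 hp)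
      exact Finset.mem_biUnion.2 ⟨x, hx, Finset.mem_filter.2 ⟨hp, h⟩⟩
    have h1 := (Finset.card_le_card hsub).trans
      (Finset.card_biUnion_le_card_mul _ _ N fun x hx => (hno x hx).le)
    rw [List.toFinset_card_of_nodup hnodup.of_map, hXk] at h1
    omega
  obtain ⟨x, -, hx⟩ := hpig
  have hxcard : N ≤ (((L.toFinset).filter
      fun p => G.graph.Within (↑p.2)ᶜ r p.1 x).image Prod.fst).card := by
    rwa [Finset.card_image_of_injOn]
    intro p hp q hq hpq
    exact List.inj_on_of_nodup_map hnodup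
      (by simpa using (Finset.mem_filter.1 hp).1) (by simpa using (Finset.mem_filter.1 hq).1) hpq
  obtain ⟨S, hS, B, hB, hBcard, hsc⟩ := hN G hG _ hxcard
  let L' := L.filter fun p => G.graph.Within (↑p.2)ᶜ r p.1 x ∧ p.1 ∈ B
  have hL' : ∀ p ∈ L', G.graph.Within (↑p.2)ᶜ r p.1 x ∧ p.1 ∈ B := fun p hp => by
    simpa using (List.mem_filter.1 hp).2
  have hBL' : B ⊆ (L'.map Prod.fst).toFinset := by
    intro b hb
    obtain ⟨p, hp, rfl⟩ := Finset.mem_image.1 (hB hb)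
    obtain ⟨hpL, hpx⟩ := Finset.mem_filter.1 hp
    rw [List.mem_toFinset]
    exact List.mem_map_of_mem (List.mem_filter.2 ⟨by simpa using hpL, by simp [hpx, hb]⟩)
  -- The at least `2 * (s + 1)` remaining entries force `s + 1` elements into `S ∩ T`, though `S`
  -- has at most `s`.
  have hfin := History.le_card_inter (x := x) (A := S) (s + 1)
    (hL.sublist (L' := L') List.filter_sublist)
    (fun p hp => (hL' p hp).1)
    (by
      rw [← two_mul]
      refine hsc.subset fun v hv => ?_
      obtain ⟨p, hp, rfl⟩ := List.mem_map.1 (List.mem_toFinset.1 hv)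
      exact (hL' p hp).2)
    (hBcard.trans ((Finset.card_le_card hBL').trans
      ((List.toFinset_card_le _).trans (by simp))))
  have := Finset.card_le_card (Finset.inter_subset_left (s₁ := S) (s₂ := T))
  omega

theorem NowhereDense.exists_isCowitness {C : Set FinGraph.{u}} (hC : NowhereDense C) (r k : ℕ) :
    ∃ c : ℕ, ∀ G ∈ C, ∀ A : Set G.V,
      ∃ Q : Finset G.V, Q.card ≤ c ∧ G.graph.IsCowitness k r A Q := by
  obtain ⟨M, hM⟩ := hC.exists_history_length_lt r k
  obtain ⟨c, hc⟩ := exists_forall_captures.{u} k r M M 0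
  refine ⟨c, fun G hG A => ?_⟩
  obtain ⟨Q, hQ, h⟩ := hc G.graph A (hM G hG A) [] ∅ (.nil _) (by simp) (by simp)
    {X | G.graph.Uncaptured k r A [] X} (fun X hX => hX) (by simp)
  exact ⟨Q, hQ, fun X _ hXk hAX a ha => h X ⟨hXk, hAX, by simp⟩ a ha⟩

/-! ### From shallow clique minors to subdivided cliques. -/

namespace SimpleGraph

/-- Under a map `π` that eventually sends all the `b j` to `c`, many of the `b j` merge at one
point simultaneously, their orbits being separate before. -/
lemma exists_iterate_merge {ι V : Type*} (π : V → V) (c : V) (h m : ℕ) (b : ι → V)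
    (J : Finset ι) (hb : ∀ j ∈ J, π^[h] (b j) = c) (hm : 0 < m) (hJ : m ^ (h + 1) ≤ J.card) :
    ∃ s ≤ h, ∃ x, ∃ J' ⊆ J, m ≤ J'.card ∧ (∀ j ∈ J', π^[s] (b j) = x) ∧
      ∀ s' < s, Set.InjOn (fun j => π^[s'] (b j)) J' := by
  classical
  induction h generalizing b J with
  | zero => exact ⟨0, le_rfl, c, J, subset_rfl, by simpa using hJ, hb, by simp⟩
  | succ h ih =>
    -- Either `m` points already coincide, or keeping one index per value costs a factor of at most
    -- `m` before the next application of `π`.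
    by_cases hex : ∃ x, m ≤ (J.filter fun j => b j = x).card
    · obtain ⟨x, hx⟩ := hex
      exact ⟨0, by omega, x, _, Finset.filter_subset _ _, hx,
        fun j hj => (Finset.mem_filter.1 hj).2, by simp⟩
    · push Not at hex
      obtain ⟨J₁, hJ₁, himg, hinj⟩ : ∃ J₁ ⊆ J, J₁.image b = J.image b ∧ Set.InjOn b J₁ := by
        obtain ⟨J₁, hJ₁, hinj, himg⟩ :=
          Finset.exists_subset_injOn_image_eq_of_surjOn (f := b) J (J.image b)
            (by rw [Finset.coe_image]; exact Set.surjOn_image _ _)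
        exact ⟨J₁, by exact_mod_cast hJ₁, himg, hinj⟩
      have h1 := Finset.card_le_mul_card_image (f := b) J m fun x _ => (hex x).le
      rw [← himg, Finset.card_image_of_injOn hinj] at h1
      have h2 : m ^ (h + 1) ≤ J₁.card := by
        rw [pow_succ'] at hJ
        exact Nat.le_of_mul_le_mul_left (hJ.trans h1) hm
      obtain ⟨s, hs, x, J', hJ', hc, hx, hi⟩ := ih (fun j => π (b j)) J₁
        (fun j hj => by rw [← Function.iterate_succ_apply]; exact hb j (hJ₁ hj)) h2
      refine ⟨s + 1, by omega, x, J', hJ'.trans hJ₁, hc,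
        fun j hj => by rw [Function.iterate_succ_apply]; exact hx j hj, fun s' hs' => ?_⟩
      cases s' with
      | zero => exact hinj.mono (by exact_mod_cast hJ')
      | succ s' => simpa only [Function.iterate_succ_apply] using hi s' (by omega)

/-- A breadth-first search tree of `B` from `c`: `d` is the depth and `π` the parent map. -/
lemma exists_parent {V : Type*} {G : SimpleGraph V} {B : Set V} {c : V} {r : ℕ}
    (hB : ∀ v ∈ B, G.Within B r c v) :
    ∃ (π : V → V) (d : V → ℕ), (∀ v ∈ B, d v ≤ r) ∧ (∀ v ∈ B, d v = 0 → v = c) ∧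
      ∀ v ∈ B, ∀ k, d v = k + 1 → π v ∈ B ∧ G.Adj (π v) v ∧ d (π v) = k := by
  classical
  let d : V → ℕ := fun v => sInf {n | G.Within B n c v}
  have hd : ∀ v ∈ B, G.Within B (d v) c v := fun v hv =>
    Nat.sInf_mem (s := {n | G.Within B n c v}) ⟨r, hB v hv⟩
  have hle : ∀ v n, G.Within B n c v → d v ≤ n := fun v n h => Nat.sInf_le h
  have hpar : ∀ v, ∃ w, v ∈ B → ∀ k, d v = k + 1 → w ∈ B ∧ G.Adj w v ∧ d w = k := by
    intro v
    by_cases hv : v ∈ B ∧ d v ≠ 0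
    · obtain ⟨hv, hne⟩ := hv
      obtain ⟨k, hk⟩ := Nat.exists_eq_succ_of_ne_zero hne
      have h := hd v hv
      rw [hk] at h
      obtain ⟨w, hw, rfl | hadj⟩ := h.exists_last
      · have := hle _ _ hw
        omega
      · refine ⟨w, fun _ k' hk' => ⟨hw.mem_right, hadj, ?_⟩⟩
        have h1 := hle _ _ hw
        have h2 := hle _ _ ((hd w hw.mem_right).trans (.of_adj hadj hw.mem_right hv))
        omega
    · exact ⟨v, fun h k hk => absurd ⟨h, by omega⟩ hv⟩
  choose π hπ using hpar
  exact ⟨π, d, fun v hv => hle v r (hB v hv),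
    fun v hv h => (h ▸ hd v hv).eq_of_zero.symm, hπ⟩

/-- In a set of bounded radius, many vertices are reached from a common vertex by short walks
that are disjoint apart from it. -/
lemma exists_fan {V ι : Type*} {G : SimpleGraph V} {B : Set V} {c : V} {r : ℕ}
    (hB : ∀ v ∈ B, G.Within B r c v) (b : ι → V) (J : Finset ι) (hb : ∀ j ∈ J, b j ∈ B) (m : ℕ)
    (hm : 0 < m) (hJ : (r + 1) * m ^ (r + 1) ≤ J.card) :
    ∃ x ∈ B, ∃ J' ⊆ J, m ≤ J'.card ∧ ∃ T : ι → Set V,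
      (∀ j ∈ J', T j ⊆ B ∧ G.Within (T j) r x (b j)) ∧
      ∀ j ∈ J', ∀ j' ∈ J', j ≠ j' → T j ∩ T j' ⊆ {x} := by
  classical
  obtain ⟨π, d, hdr, hd0, hπ⟩ := exists_parent hB
  -- Restricting to one depth makes two tree paths meet only after equally many steps, so they meet
  -- only at the merging point.
  obtain ⟨h, hh, hcard⟩ := Finset.exists_le_card_fiber_of_mul_le_card_of_maps_to
    (s := J) (t := Finset.range (r + 1)) (f := fun j => d (b j)) (n := m ^ (r + 1))
    (fun j hj => Finset.mem_range.2 (Nat.lt_succ_of_le (hdr _ (hb j hj)))) (by simp)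
    (by simpa using hJ)
  rw [Finset.mem_range] at hh
  have hiter : ∀ s, ∀ v ∈ B, s ≤ d v → π^[s] v ∈ B ∧ d (π^[s] v) = d v - s := by
    intro s
    induction s with
    | zero => exact fun v hv _ => ⟨hv, rfl⟩
    | succ s ih =>
      intro v hv hs
      obtain ⟨h1, h2⟩ := ih v hv (by omega)
      obtain ⟨h3, -, h4⟩ := hπ _ h1 (d v - (s + 1)) (by omega)
      rw [Function.iterate_succ_apply']
      exact ⟨h3, h4⟩
  have hJB : ∀ j ∈ J.filter (fun j => d (b j) = h), b j ∈ B ∧ d (b j) = h := fun j hj =>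
    ⟨hb j (Finset.mem_filter.1 hj).1, (Finset.mem_filter.1 hj).2⟩
  obtain ⟨s, hs, x, J', hJ', hc, hx, hinj⟩ := exists_iterate_merge π c h m b _
    (fun j hj => by
      obtain ⟨h1, h2⟩ := hJB j hj
      obtain ⟨h3, h4⟩ := hiter h _ h1 h2.ge
      exact hd0 _ h3 (by omega)) hm
    ((Nat.pow_le_pow_right hm (by omega)).trans hcard)
  obtain ⟨j₀, hj₀⟩ : J'.Nonempty := Finset.card_pos.1 (by omega)
  have hJ'B := fun j hj => hJB j (hJ' hj)
  refine ⟨x, ?_, J', hJ'.trans (Finset.filter_subset _ _), hc,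
    fun j => {w | ∃ i ≤ s, π^[i] (b j) = w}, fun j hj => ⟨?_, ?_⟩, ?_⟩
  · rw [← hx j₀ hj₀]
    exact (hiter s _ (hJ'B j₀ hj₀).1 (by rw [(hJ'B j₀ hj₀).2]; exact hs)).1
  · rintro _ ⟨i, hi, rfl⟩
    exact (hiter i _ (hJ'B j hj).1 (by rw [(hJ'B j hj).2]; omega)).1
  · obtain ⟨h1, h2⟩ := hJ'B j hj
    have key : ∀ i ≤ s, G.Within {w | ∃ i ≤ s, π^[i] (b j) = w} i (b j) (π^[i] (b j)) := by
      intro i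
      induction i with
      | zero => exact fun _ => .refl ⟨0, by omega, rfl⟩
      | succ i ih =>
        intro hi
        obtain ⟨h3, h4⟩ := hiter i _ h1 (by omega)
        obtain ⟨-, h5, -⟩ := hπ _ h3 (d (b j) - (i + 1)) (by omega)
        rw [Function.iterate_succ_apply']
        refine (ih (by omega)).trans (.of_adj h5.symm ⟨i, by omega, rfl⟩ ⟨i + 1, hi, ?_⟩)
        rw [Function.iterate_succ_apply']
    have := key s le_rfl
    rw [hx j hj] at this
    exact this.symm.mono subset_rfl (by omega)
  · rintro j hj j' hj' hne w ⟨⟨i, hi, hw⟩, ⟨i', hi', hw'⟩⟩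
    obtain ⟨h1, h2⟩ := hJ'B j hj
    obtain ⟨h1', h2'⟩ := hJ'B j' hj'
    have h3 := (hiter i _ h1 (by omega)).2
    have h3' := (hiter i' _ h1' (by omega)).2
    rw [hw] at h3
    rw [hw'] at h3'
    obtain rfl : i = i' := by omega
    rcases hi.lt_or_eq with hlt | rfl
    · exact absurd (hinj i hlt hj hj' (hw.trans hw'.symm)) hne
    · exact hw.symm.trans (hx j hj)

/-- Greedy choice: pick one branch set, keep only the indices reached by its fan, and repeat. The
indices in `K` will carry branch vertices, those left in `J` will serve as connectors. -/
lemma exists_fans (r n M : ℕ) : ∃ N : ℕ, ∀ {V : Type u} {ι : Type} (G : SimpleGraph V)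
    (c : ι → V) (B : ι → Set V) (b : ι → ι → V), (∀ i, ∀ v ∈ B i, G.Within (B i) r (c i) v) →
    (∀ i j, b i j ∈ B i) → ∀ I : Finset ι, N ≤ I.card →
    ∃ K ⊆ I, ∃ J ⊆ I, Disjoint K J ∧ K.card = n ∧ M ≤ J.card ∧
      ∃ (x : ι → V) (T : ι → ι → Set V), ∀ i ∈ K, x i ∈ B i ∧
        (∀ j ∈ J, T i j ⊆ B i ∧ G.Within (T i j) r (x i) (b i j)) ∧
        ∀ j ∈ J, ∀ j' ∈ J, j ≠ j' → T i j ∩ T i j' ⊆ {x i} := by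
  classical
  induction n with
  | zero =>
    exact ⟨M, fun G c B b _ _ I hI => ⟨∅, by simp, I, subset_rfl, by simp, by simp, hI,
      c, fun _ _ => ∅, by simp⟩⟩
  | succ n ih =>
    obtain ⟨N, hN⟩ := ih
    refine ⟨1 + (r + 1) * (N + 1) ^ (r + 1), fun G c B b hB hb I hI => ?_⟩
    obtain ⟨i, hi⟩ : I.Nonempty := Finset.card_pos.1 (by omega)
    obtain ⟨x₀, hx₀, J₀, hJ₀, hJ₀c, T₀, hT₀, hT₀'⟩ := exists_fan (hB i) (b i) (I.erase i)
      (fun j _ => hb i j) (N + 1) (by omega) (by rw [Finset.card_erase_of_mem hi]; omega)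
    obtain ⟨K, hK, J, hJ, hKJ, hKc, hJc, x, T, hxT⟩ := hN G c B b hB hb J₀ (by omega)
    have hiJ₀ : i ∉ J₀ := fun h => by simpa using hJ₀ h
    have hsub : J₀ ⊆ I := hJ₀.trans (Finset.erase_subset _ _)
    refine ⟨insert i K, Finset.insert_subset hi (hK.trans hsub), J, hJ.trans hsub, ?_, ?_, hJc,
      Function.update x i x₀, Function.update T i T₀, fun k hk => ?_⟩
    · rw [Finset.disjoint_insert_left]
      exact ⟨fun h => hiJ₀ (hJ h), hKJ⟩
    · rw [Finset.card_insert_of_notMem fun h => hiJ₀ (hK h), hKc]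
    · rcases Finset.mem_insert.1 hk with rfl | hk
      · simp only [Function.update_self]
        exact ⟨hx₀, fun j hj => hT₀ j (hJ hj), fun j hj j' hj' => hT₀' j (hJ hj) j' (hJ hj')⟩
      · have hne : k ≠ i := fun h => hiJ₀ (h ▸ hK hk)
        simp only [Function.update_of_ne hne]
        exact hxT k hk

/-- The vertices `f i` and the sets `U s(i, j)` meet only in the way the branch vertices and the
paths of a subdivided clique do. -/
structure IsSubdivisionFrame {V : Type*} {n : ℕ} (f : Fin n → V) (U : Sym2 (Fin n) → Set V) :
    Prop where
  injective : Function.Injective f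
  inter : ∀ e e', e ≠ e' → ∀ w ∈ U e, w ∈ U e' → w ∈ Set.range f
  mem : ∀ e k, f k ∈ U e → k ∈ e

lemma IsSubdivisionFrame.comp {V : Type*} {n n' : ℕ} {f : Fin n → V} {U : Sym2 (Fin n) → Set V}
    (h : IsSubdivisionFrame f U) {g : Fin n' → Fin n} (hg : Function.Injective g) :
    IsSubdivisionFrame (f ∘ g) (U ∘ Sym2.map g) where
  injective := h.injective.comp hg
  inter e e' hne w hw hw' := by
    obtain ⟨k, rfl⟩ := h.inter _ _ (fun h => hne (Sym2.map.injective hg h)) w hw hw'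
    have hk := h.mem _ _ hw
    obtain ⟨a, -, rfl⟩ := Sym2.mem_map.1 hk
    exact ⟨a, rfl⟩
  mem e k hk := by
    obtain ⟨a, ha, hak⟩ := Sym2.mem_map.1 (h.mem _ _ hk)
    exact hg hak ▸ ha

/-- `G` contains a clique on `n` vertices with each edge replaced by a path of length at most
`l`. -/
def HasSubdivision {V : Type*} (G : SimpleGraph V) (n l : ℕ) : Prop :=
  ∃ (f : Fin n → V) (U : Sym2 (Fin n) → Set V), IsSubdivisionFrame f U ∧
    ∀ i j, i ≠ j → G.Within (U s(i, j)) l (f i) (f j)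

/-- Every pair of branch vertices gets its own connecting branch set. Each end reaches the center of
the connector by a fan path, an edge and a path inside the connector, of total length at most `2 * r
+ 1`. -/
theorem exists_hasSubdivision_of_hasCliqueMinor (r n : ℕ) : ∃ t : ℕ, ∀ {V : Type u}
    (G : SimpleGraph V), G.HasCliqueMinor r t → G.HasSubdivision n (4 * r + 2) := by
  classical
  obtain ⟨t, ht⟩ := exists_fans.{u} r n (Fintype.card (Sym2 (Fin n)))
  refine ⟨t, fun {V} G ⟨c, B, hcB, hB, hdisj, hadj⟩ => ?_⟩
  have hadj' : ∀ i j, ∃ u ∈ B i, ∃ v, i ≠ j → v ∈ B j ∧ G.Adj u v := by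
    intro i j
    by_cases hij : i = j
    · exact ⟨c i, hcB i, c i, fun h => absurd hij h⟩
    · obtain ⟨u, hu, v, hv, huv⟩ := HasCliqueMinor.exists_adj hadj i j hij
      exact ⟨u, hu, v, fun _ => ⟨hv, huv⟩⟩
  choose b hb b' hb' using hadj'
  obtain ⟨K, -, J, -, hKJ, hKc, hJc, x, T, hxT⟩ := ht G c B b hB hb Finset.univ (by simp)
  have hBdisj : ∀ i j w, w ∈ B i → w ∈ B j → i = j := by
    intro i j w hi hj
    by_contra hne
    exact Set.disjoint_left.1 (hdisj i j hne) hi hj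
  let e := K.equivFinOfCardEq hKc
  let κ : Fin n → Fin t := fun a => e.symm a
  have hκK : ∀ a, κ a ∈ K := fun a => (e.symm a).2
  have hκ : Function.Injective κ := fun a a' h => e.symm.injective (Subtype.ext h)
  obtain ⟨μ'⟩ : Nonempty (Sym2 (Fin n) ↪ J) :=
    Function.Embedding.nonempty_of_card_le (by simpa using hJc)
  let μ : Sym2 (Fin n) → Fin t := fun p => μ' p
  have hμJ : ∀ p, μ p ∈ J := fun p => (μ' p).2
  have hμ : Function.Injective μ := fun p p' h => μ'.injective (Subtype.ext h)
  have hne : ∀ a p, κ a ≠ μ p := fun a p h => Finset.disjoint_left.1 hKJ (hκK a) (h ▸ hμJ p)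
  have hTB : ∀ a p, T (κ a) (μ p) ⊆ B (κ a) := fun a p => ((hxT _ (hκK a)).2.1 _ (hμJ p)).1
  refine ⟨fun a => x (κ a), fun p => {w | ∃ a ∈ p, w ∈ T (κ a) (μ p)} ∪ B (μ p), ⟨?_, ?_, ?_⟩, ?_⟩
  · intro a a' h
    exact hκ (hBdisj _ _ (x (κ a)) (hxT _ (hκK a)).1
      (by simp only at h; rw [h]; exact (hxT _ (hκK a')).1))
  · rintro p p' hpp' w (⟨a, ha, hw⟩ | hw) (⟨a', ha', hw'⟩ | hw')
    · obtain rfl := hκ (hBdisj _ _ w (hTB a p hw) (hTB a' p' hw'))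
      have := (hxT _ (hκK a)).2.2 _ (hμJ p) _ (hμJ p') (fun h => hpp' (hμ h)) ⟨hw, hw'⟩
      exact ⟨a, this.symm⟩
    · exact absurd (hBdisj _ _ w (hTB a p hw) hw') (hne a p')
    · exact absurd (hBdisj _ _ w (hTB a' p' hw') hw) (hne a' p)
    · exact absurd (hμ (hBdisj _ _ w hw hw')) hpp'
  · rintro p k (⟨a, ha, hw⟩ | hw)
    · exact hκ (hBdisj _ _ _ (hxT _ (hκK k)).1 (hTB a p hw)) ▸ ha
    · exact absurd (hBdisj _ _ _ (hxT _ (hκK k)).1 hw) (hne k p)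
  · have key : ∀ p : Sym2 (Fin n), ∀ a ∈ p,
        G.Within ({w | ∃ a ∈ p, w ∈ T (κ a) (μ p)} ∪ B (μ p)) (r + 1 + r) (x (κ a)) (c (μ p)) := by
      intro p a ha
      have hsub : T (κ a) (μ p) ⊆ {w | ∃ a ∈ p, w ∈ T (κ a) (μ p)} ∪ B (μ p) :=
        fun w hw => Or.inl ⟨a, ha, hw⟩
      have h1 := ((hxT _ (hκK a)).2.1 _ (hμJ p)).2
      obtain ⟨h2, h3⟩ := hb' (κ a) (μ p) (hne a p)
      exact ((h1.mono hsub le_rfl).trans (.of_adj h3 (hsub h1.mem_right) (Or.inr h2))).trans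
        ((hB _ _ h2).symm.mono Set.subset_union_right le_rfl)
    intro i j _
    exact ((key s(i, j) i (by simp)).trans (key s(i, j) j (by simp)).symm).mono subset_rfl
      (by omega)

end SimpleGraph

/-! ### Subdivided cliques have no small cowitnesses. -/

namespace SimpleGraph

/-- The sets of a frame can be shrunk so that each vertex is close to an end. -/
lemma IsSubdivisionFrame.exists_shrink {V : Type*} {G : SimpleGraph V} {n l : ℕ} {f : Fin n → V}
    {U : Sym2 (Fin n) → Set V} (h : IsSubdivisionFrame f U)
    (hU : ∀ i j, i ≠ j → G.Within (U s(i, j)) l (f i) (f j)) :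
    ∃ T : Sym2 (Fin n) → Set V, IsSubdivisionFrame f T ∧ (∀ e, T e ⊆ U e) ∧
      (∀ e, e.IsDiag → T e = ∅) ∧ ∀ i j, i ≠ j → G.Within (T s(i, j)) l (f i) (f j) ∧
        ∀ w ∈ T s(i, j), G.Within (T s(i, j)) (l / 2) (f i) w ∨
          G.Within (T s(i, j)) (l / 2) (f j) w := by
  classical
  have key : ∀ e, ∃ T ⊆ U e, (e.IsDiag → T = ∅) ∧ ∀ i j, i ≠ j → e = s(i, j) →
      G.Within T l (f i) (f j) ∧
        ∀ w ∈ T, G.Within T (l / 2) (f i) w ∨ G.Within T (l / 2) (f j) w := by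
    intro e
    induction e with
    | _ i j =>
    by_cases hij : i = j
    · subst hij
      refine ⟨∅, by simp, by simp, fun a b hab he => ?_⟩
      rw [Sym2.eq_iff] at he
      rcases he with ⟨rfl, rfl⟩ | ⟨rfl, rfl⟩ <;> exact absurd rfl hab
    · obtain ⟨p, hp, hpU⟩ := hU i j hij
      have hmain : G.Within {w | w ∈ p.support} l (f i) (f j) ∧
          ∀ w ∈ {w | w ∈ p.support}, G.Within {w | w ∈ p.support} (l / 2) (f i) w ∨
            G.Within {w | w ∈ p.support} (l / 2) (f j) w := by
        refine ⟨⟨p, hp, fun _ h => h⟩, fun w hw => ?_⟩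
        have hlen : (p.takeUntil w hw).length + (p.dropUntil w hw).length = p.length := by
          rw [← Walk.length_append, Walk.take_spec]
        rcases le_or_gt (p.takeUntil w hw).length (l / 2) with h1 | h1
        · exact Or.inl ⟨_, h1, fun x hx => p.support_takeUntil_subset_support hw hx⟩
        · refine Or.inr (Within.symm ⟨p.dropUntil w hw, by omega,
            fun x hx => p.support_dropUntil_subset_support hw hx⟩)
      refine ⟨{w | w ∈ p.support}, hpU, fun hd => absurd (by simpa using hd) hij,
        fun a b hab he => ?_⟩
      rw [Sym2.eq_iff] at he
      rcases he with ⟨rfl, rfl⟩ | ⟨rfl, rfl⟩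
      · exact hmain
      · exact ⟨hmain.1.symm, fun w hw => (hmain.2 w hw).symm⟩
  choose T hTU hTd hT using key
  exact ⟨T, ⟨h.injective, fun e e' hne w hw hw' => h.inter e e' hne w (hTU e hw) (hTU e' hw'),
    fun e k hk => h.mem e k (hTU e hk)⟩, hTU, hTd, fun i j hij => hT _ i j hij rfl⟩

/-- In the union of a frame, all of whose paths have length `l`, walks shorter than `l` do not
leave the open star of a branch vertex. -/
lemma IsSubdivisionFrame.eq_or_exists_of_walk {V : Type*} {G : SimpleGraph V} {n l : ℕ}
    {f : Fin n → V} {T : Sym2 (Fin n) → Set V} (h : IsSubdivisionFrame f T)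
    (hd : ∀ e, e.IsDiag → T e = ∅)
    (hl : ∀ i j, i ≠ j → ¬ G.Within (T s(i, j)) (l - 1) (f i) (f j)) {H : G.Subgraph}
    (hH : ∀ u v, H.Adj u v → ∃ e, u ∈ T e ∧ v ∈ T e) (i : Fin n) {y x : H.verts}
    (p : H.coe.Walk y x) (hx : (x : V) = f i) (hp : p.length < l) :
    (y : V) = f i ∨ ((y : V) ∉ Set.range f ∧
      ∃ j ≠ i, G.Within (T s(i, j)) p.length y (f i)) := by
  induction p with
  | nil => exact Or.inl hx
  | @cons u v x hadj q ih =>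
    rw [Walk.length_cons] at hp
    have hlen : (Walk.cons hadj q).length = q.length + 1 := Walk.length_cons hadj q
    -- Reaching the far end of a path would take at least `l` steps.
    have hfar : ∀ j ≠ i, G.Within (T s(i, j)) (q.length + 1) (u : V) (f i) → (u : V) ≠ f j := by
      intro j hj hw hu
      exact hl i j hj.symm ((hu ▸ hw.symm).mono subset_rfl (by omega))
    have hfin : ∀ j ≠ i, G.Within (T s(i, j)) (q.length + 1) (u : V) (f i) →
        (u : V) = f i ∨ ((u : V) ∉ Set.range f ∧
          ∃ j ≠ i, G.Within (T s(i, j)) (Walk.cons hadj q).length u (f i)) := by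
      intro j hj hw
      by_cases hu : (u : V) ∈ Set.range f
      · obtain ⟨k, hk⟩ := hu
        have hmem := hw.mem_left
        rw [← hk] at hmem
        rcases Sym2.mem_iff.1 (h.mem _ _ hmem) with rfl | rfl
        · exact Or.inl hk.symm
        · exact absurd hk.symm (hfar _ hj hw)
      · exact Or.inr ⟨hu, j, hj, hlen ▸ hw⟩
    obtain ⟨e, hue, hve⟩ := hH _ _ hadj
    have huv : G.Adj (u : V) v := H.adj_sub hadj
    rcases ih hx (by omega) with hv | ⟨hv, j, hj, hw⟩
    · rw [hv] at hve
      obtain ⟨j, rfl⟩ := Sym2.mem_iff_exists.1 (h.mem _ _ hve)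
      have hj : j ≠ i := by
        rintro rfl
        rw [hd _ (by simp)] at hve
        exact hve
      exact hfin j hj ((Within.of_adj (hv ▸ huv) hue hve).mono subset_rfl (by omega))
    · have he : e = s(i, j) := by
        by_contra hne
        exact hv (h.inter _ _ hne _ hve hw.mem_left)
      subst he
      exact hfin j hj (((Within.of_adj huv hue hve).trans hw).mono subset_rfl (by omega))

/-- A clique with each edge replaced by a path of length `l` has no small cowitness. -/
theorem IsSubdivisionFrame.exists_subgraph {V : Type*} {G : SimpleGraph V} {n l : ℕ}
    {f : Fin n → V} {U : Sym2 (Fin n) → Set V} (h : IsSubdivisionFrame f U) (hn : 2 ≤ n)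
    (hU : ∀ i j, i ≠ j → G.Within (U s(i, j)) l (f i) (f j))
    (hl : ∀ i j, i ≠ j → ¬ G.Within (U s(i, j)) (l - 1) (f i) (f j)) :
    ∃ H : G.Subgraph, ∀ Q : Finset H.verts, H.coe.IsCowitness 1 (l + l / 2) Set.univ Q →
      n ≤ 2 * Q.card := by
  classical
  obtain ⟨T, hT, hTU, hTd, hTw⟩ := h.exists_shrink hU
  have hTl : ∀ i j, i ≠ j → ¬ G.Within (T s(i, j)) (l - 1) (f i) (f j) := fun i j hij hw =>
    hl i j hij (hw.mono (hTU _) le_rfl)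
  let H : G.Subgraph :=
    { verts := ⋃ e, T e
      Adj := fun u v => G.Adj u v ∧ ∃ e, u ∈ T e ∧ v ∈ T e
      adj_sub := fun h => h.1
      edge_vert := fun h => Set.mem_iUnion.2 ⟨h.2.choose, h.2.choose_spec.1⟩
      symm := ⟨fun u v h => ⟨h.1.symm, h.2.choose, h.2.choose_spec.2, h.2.choose_spec.1⟩⟩ }
  have hTH : ∀ e, T e ⊆ H.verts := fun e => Set.subset_iUnion T e
  have hother : ∀ i : Fin n, ∃ j, j ≠ i := fun i => by
    have : Nontrivial (Fin n) := Fin.nontrivial_iff_two_le.2 hn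
    exact exists_ne i
  have hfH : ∀ i, f i ∈ H.verts := fun i => by
    obtain ⟨j, hj⟩ := hother i
    exact hTH _ (hTw i j hj.symm).1.mem_left
  have hedist : ∀ e m u v (hu : u ∈ H.verts) (hv : v ∈ H.verts), G.Within (T e) m u v →
      H.coe.edist ⟨u, hu⟩ ⟨v, hv⟩ ≤ m := by
    intro e m u v hu hv hw
    obtain ⟨p, hp⟩ := H.exists_coe_walk_of_within (hTH e)
      (fun x hx y hy hxy => ⟨hxy, e, hx, hy⟩) hw
    exact (edist_le p).trans (by exact_mod_cast hp)
  have hbranch : ∀ i j, H.coe.edist ⟨f i, hfH i⟩ ⟨f j, hfH j⟩ ≤ l := by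
    intro i j
    by_cases hij : i = j
    · subst hij; simp
    · exact hedist _ _ _ _ _ _ (hTw i j hij).1
  -- At most `l / 2` steps to the nearer end, then at most `l` to any other branch vertex.
  have hdom : ∀ k (v : H.verts), H.coe.edist v ⟨f k, hfH k⟩ ≤ (l + l / 2 : ℕ) := by
    rintro k ⟨v, hv⟩
    obtain ⟨e, he⟩ := Set.mem_iUnion.1 hv
    obtain ⟨i, hi⟩ : ∃ i, G.Within (T e) (l / 2) (f i) v := by
      induction e with
      | _ i j =>
      by_cases hij : i = j
      · rw [hTd _ (by simpa using hij)] at he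
        exact absurd he (by simp)
      · rcases (hTw i j hij).2 v he with h | h
        exacts [⟨i, h⟩, ⟨j, h⟩]
    have h1 := hedist e _ _ _ hv (hfH i) hi.symm
    refine (H.coe.edist_triangle (v := ⟨f i, hfH i⟩)).trans ?_
    rw [add_comm l, Nat.cast_add]
    exact add_le_add h1 (hbranch i k)
  refine ⟨H, fun Q hQ => ?_⟩
  have hl0 : 0 < l := by
    obtain ⟨j, hj⟩ := hother ⟨0, by omega⟩
    by_contra! h0
    have hw := (hTw _ j hj.symm).1
    rw [Nat.le_zero.1 h0] at hw
    exact hj (h.injective hw.eq_of_zero).symm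
  let near : H.verts → Fin n → Prop := fun q k => (q : V) = f k ∨
    ((q : V) ∉ Set.range f ∧ ∃ j ≠ k, (q : V) ∈ T s(k, j))
  have hnear : ∀ k, ∃ q ∈ Q, near q k := by
    intro k
    -- Test the cowitness with `X = {f k}` and `a = f k`: the walk is closed and shorter than `2 *
    -- l`, so one of its two parts joins `q` to `f k` in fewer than `l` steps.
    obtain ⟨y, hy, p, hp, q, hq, hqp⟩ := hQ {⟨f k, hfH k⟩} (by simp) (by simp)
      (fun v _ => ⟨⟨f k, hfH k⟩, by simp, hdom k v⟩) ⟨f k, hfH k⟩ trivial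
    obtain rfl : y = ⟨f k, hfH k⟩ := by simpa using hy
    have hlen : (p.takeUntil q hqp).length + (p.dropUntil q hqp).length = p.length := by
      rw [← Walk.length_append, Walk.take_spec]
    obtain ⟨P, hP⟩ : ∃ P : H.coe.Walk q ⟨f k, hfH k⟩, P.length < l := by
      rcases lt_or_ge (p.dropUntil q hqp).length l with h1 | h1
      · exact ⟨_, h1⟩
      · exact ⟨(p.takeUntil q hqp).reverse, by rw [Walk.length_reverse]; omega⟩
    refine ⟨q, hq, ?_⟩
    rcases hT.eq_or_exists_of_walk hTd hTl (H := H) (fun u v huv => huv.2) k P rfl hP with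
      h | ⟨h, j, hj, hw⟩
    · exact Or.inl h
    · exact Or.inr ⟨h, j, hj, hw.mem_left⟩
  have htwo : ∀ q ∈ Q, (Finset.univ.filter (near q)).card ≤ 2 := by
    intro q _
    by_contra! hlt
    obtain ⟨a, b, c, ha, hb, hc, hab, hac, hbc⟩ := Finset.two_lt_card_iff.1 hlt
    simp only [Finset.mem_filter, Finset.mem_univ, true_and] at ha hb hc
    by_cases hq : (q : V) ∈ Set.range f
    · have h1 := ha.resolve_right fun h => h.1 hq
      have h2 := hb.resolve_right fun h => h.1 hq
      exact hab (h.injective (h1.symm.trans h2))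
    · have hres : ∀ k, near q k → ∃ j ≠ k, (q : V) ∈ T s(k, j) := fun k hk =>
        (hk.resolve_left fun h => hq ⟨k, h.symm⟩).2
      obtain ⟨a', -, ha'⟩ := hres a ha
      obtain ⟨b', -, hb'⟩ := hres b hb
      obtain ⟨c', -, hc'⟩ := hres c hc
      have heq : ∀ e e', (q : V) ∈ T e → (q : V) ∈ T e' → e = e' := fun e e' h h' => by
        by_contra hne
        exact hq (hT.inter e e' hne _ h h')
      have hb1 : b ∈ s(a, a') := heq _ _ hb' ha' ▸ Sym2.mem_mk_left b b'
      have hc1 : c ∈ s(a, a') := heq _ _ hc' ha' ▸ Sym2.mem_mk_left c c'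
      rcases Sym2.mem_iff.1 hb1 with rfl | rfl
      · exact hab rfl
      · rcases Sym2.mem_iff.1 hc1 with rfl | rfl
        · exact hac rfl
        · exact hbc rfl
  have hcover : (Finset.univ : Finset (Fin n)) ⊆ Q.biUnion fun q => Finset.univ.filter (near q) := by
    intro k _
    obtain ⟨q, hq, hk⟩ := hnear k
    exact Finset.mem_biUnion.2 ⟨q, hq, by simpa using hk⟩
  have := (Finset.card_le_card hcover).trans (Finset.card_biUnion_le_card_mul _ _ 2 htwo)
  rw [Finset.card_univ, Fintype.card_fin] at this
  omega

/-- By Ramsey's theorem, a large subdivided clique contains one with shorter paths, or one with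
all paths of maximal length. -/
theorem exists_hasSubdivision_or_exact (n₁ n₂ l : ℕ) : ∃ N : ℕ, ∀ {V : Type u}
    (G : SimpleGraph V), G.HasSubdivision N l → G.HasSubdivision n₁ (l - 1) ∨
      ∃ (f : Fin n₂ → V) (U : Sym2 (Fin n₂) → Set V), IsSubdivisionFrame f U ∧
        (∀ i j, i ≠ j → G.Within (U s(i, j)) l (f i) (f j)) ∧
        ∀ i j, i ≠ j → ¬ G.Within (U s(i, j)) (l - 1) (f i) (f j) := by
  obtain ⟨N, hN⟩ := exists_ramsey.{0} n₁ n₂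
  refine ⟨N, fun {V} G ⟨f, U, hf, hU⟩ => ?_⟩
  have hsymm : ∀ i j, G.Within (U s(i, j)) (l - 1) (f i) (f j) →
      G.Within (U s(j, i)) (l - 1) (f j) (f i) := fun i j h => by
    rw [Sym2.eq_swap]
    exact h.symm
  rcases hN _ hsymm Finset.univ (by simp) with ⟨K, -, hK, hr⟩ | ⟨K, -, hK, hr⟩
  all_goals
    let e := K.equivFinOfCardEq hK
    have he : Function.Injective fun a => (e.symm a : Fin N) := fun a b h =>
      e.symm.injective (Subtype.ext h)
  · exact Or.inl ⟨_, _, hf.comp he, fun i j hij =>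
      hr _ (e.symm i).2 _ (e.symm j).2 (he.ne hij)⟩
  · exact Or.inr ⟨_, _, hf.comp he, fun i j hij => hU _ _ (he.ne hij), fun i j hij =>
      hr _ (e.symm i).2 _ (e.symm j).2 (he.ne hij)⟩

end SimpleGraph

open SimpleGraph

theorem NowhereDense.of_exists_isCowitness {C : Set FinGraph.{u}} (hC : SubgraphClosed C)
    (h : ∀ r : ℕ, ∃ c : ℕ, ∀ G ∈ C,
      ∃ Q : Finset G.V, Q.card ≤ c ∧ G.graph.IsCowitness 1 r Set.univ Q) : NowhereDense C := by
  classical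
  by_contra hND
  have hex : ∃ l, ∀ n, ∃ G ∈ C, G.graph.HasSubdivision n l := by
    simp only [NowhereDense, isShallowMinor_completeGraph_iff] at hND
    push Not at hND
    obtain ⟨r, hr⟩ := hND
    refine ⟨4 * r + 2, fun n => ?_⟩
    obtain ⟨t, ht⟩ := exists_hasSubdivision_of_hasCliqueMinor.{u} r n
    obtain ⟨G, hG, hGt⟩ := hr t
    exact ⟨G, hG, ht G.graph hGt⟩
  -- By minimality of `l`, the subdivided cliques with paths of length at most `l - 1` have bounded
  -- size in `C`, which rules out the first Ramsey alternative.
  let l := Nat.find hex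
  have hl : ∀ n, ∃ G ∈ C, G.graph.HasSubdivision n l := Nat.find_spec hex
  have hl0 : l ≠ 0 := by
    intro h0
    obtain ⟨G, -, f, U, hf, hU⟩ := hl 2
    have := (hU 0 1 (by simp))
    rw [h0] at this
    exact absurd (hf.injective this.eq_of_zero) (by simp)
  obtain ⟨n₁, hn₁⟩ : ∃ n, ∀ G ∈ C, ¬ G.graph.HasSubdivision n (l - 1) := by
    have := Nat.find_min hex (show l - 1 < l by omega)
    push Not at this
    exact this
  obtain ⟨c, hc⟩ := h (l + l / 2)
  -- With `2 * c + 2` branch vertices, a cowitness needs at least `c + 1` elements.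
  obtain ⟨N, hN⟩ := exists_hasSubdivision_or_exact.{u} n₁ (2 * c + 2) l
  obtain ⟨G, hG, hGN⟩ := hl N
  obtain ⟨f, U, hf, hU, hU'⟩ := (hN G.graph hGN).resolve_left (hn₁ G hG)
  obtain ⟨H, hH⟩ := hf.exists_subgraph (by omega) hU hU'
  obtain ⟨Q, hQ, hQc⟩ := hc _ (hC G hG H)
  have := hH Q hQc
  have hQ' : Finset.card (α := H.verts) Q ≤ c := hQ
  omega

theorem theorem1p8 (C : Set FinGraph.{u}) (hC : SubgraphClosed C) :
    List.TFAE [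
      NowhereDense C,
      ∀ r k : ℕ, ∃ c : ℕ, ∀ G ∈ C, ∀ A : Set G.V,
        ∃ Q : Finset G.V, Q.card ≤ c ∧ G.graph.IsCowitness k r A Q,
      ∀ r : ℕ, ∃ c : ℕ, ∀ G ∈ C,
        ∃ Q : Finset G.V, Q.card ≤ c ∧ G.graph.IsCowitness 1 r Set.univ Q] := by
  tfae_have 1 → 2 := fun h r k => h.exists_isCowitness r k
  tfae_have 2 → 3 := fun h r => by
    obtain ⟨c, hc⟩ := h r 1
    exact ⟨c, fun G hG => hc G hG Set.univ⟩
  tfae_have 3 → 1 := fun h => .of_exists_isCowitness hC h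
  tfae_finish
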